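/- Let $\Bbbk$ be any field, let $X=\{1,2\}$, let $X^*$ be the binary rooted tree of finite words over $X$ and $X^\omega$ its boundary, the set of infinite words. Let $\mathfrak G\le\operatorname{Aut}(X^*)$ be the Grigorchuk group, generated by the automorphisms $a,b,c,d$ defined recursively by $a(1w)=2w$, $a(2w)=1w$, and $$b(1w)=1\,a(w),\quad b(2w)=2\,c(w),\qquad c(1w)=1\,a(w),\quad c(2w)=2\,d(w),\qquad d(1w)=1w,\quad d(2w)=2\,b(w).$$ Let $\mathfrak A$ be its tree enveloping algebra, i.e. the image of the group algebra $\Bbbk\mathfrak G$ in $\operatorname{End}_\Bbbk(\Bbbk X^\omega)$, where $\Bbbk X^\omega$ is the vector space with basis $X^\omega$ and $\mathfrak G$ permutes this basis. The decomposition $X^\omega=1X^\omega\sqcup 2X^\omega$ induces an algebra homomorphism $\psi:\mathfrak A\to M_2(\mathfrak A)$, for which $$a\mapsto\begin{pmatrix}0&1\\1&0\end{pmatrix},\quad b\mapsto\begin{pmatrix}a&0\\0&c\end{pmatrix},\quad c\mapsto\begin{pmatrix}a&0\\0&d\end{pmatrix},\quad d\mapsto\begin{pmatrix}1&0\\0&b\end{pmatrix}.$$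 Let $K$ be the normal closure of $[a,b]$ in $\mathfrak G$, and let $\mathcal K$ be the two-sided ideal of $\mathfrak A$ generated by the elements $h-1$ with $h\in K$. All ideals below are two-sided. Then: 1. $\mathfrak A$ is regular branch: $\psi$ is injective, each of the four maps $\mathfrak A\to\mathfrak A$, $u\mapsto\psi(u)_{x,y}$, is onto, and there is an ideal $\mathcal I$ of $\mathfrak A$ of finite codimension with $M_2(\mathcal I)\subseteq\psi(\mathcal I)$. 2. $\mathfrak A$ is just-infinite: it is infinite-dimensional over $\Bbbk$, and every non-zero ideal of $\mathfrak A$ has finite codimension. 3. $\mathfrak A$ is prime: $\mathcal I\mathcal J\ne0$ for all non-zero ideals $\mathcal I,\mathcal J$ of $\mathfrak A$. 4. The branching ideal $\mathcal K$ has finite codimension in $\mathfrak A$ and satisfies $M_2(\mathcal K)\subseteq\psi(\mathcal K)$. Moreover $\psi^{-1}(M_2(\mathcal K))\cap\mathcal K$ has finite codimension in $\mathcal K$, and $\psi(\mathfrak A)$ has finite codimension in $M_2(\mathfrak A)$. -/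

import Mathlib

noncomputable section

namespace TreeAlgebra

/-! ### Automorphisms of the regular rooted tree and their action on the boundary -/

/-- The group of automorphisms of the regular rooted tree on the alphabet `X`. The vertices are the
words over `X`, the root is the empty word, and an automorphism is a permutation of the vertices
that preserves the levels and the ancestor (prefix) relation. -/
def TreeAut (X : Type*) : Subgroup (Equiv.Perm (List X)) where
  carrier := {g | (∀ w, (g w).length = w.length) ∧ ∀ u v, g u <+: g v ↔ u <+: v}
  mul_mem' := by
    rintro g h ⟨hg, hg'⟩ ⟨hh, hh'⟩
    exact ⟨fun w => by simp [hg, hh], fun u v => by simp [hg', hh']⟩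
  one_mem' := ⟨fun _ => rfl, fun _ _ => Iff.rfl⟩
  inv_mem' := by
    rintro g ⟨hg, hg'⟩
    refine ⟨fun w => ?_, fun u v => ?_⟩
    · have := hg (g⁻¹ w)
      simpa using this.symm
    · have := hg' (g⁻¹ u) (g⁻¹ v)
      simpa using this.symm

/-- The word formed by the first `n` letters of an infinite sequence. -/
def pref {X : Type*} (ξ : ℕ → X) (n : ℕ) : List X := List.ofFn fun i : Fin n => ξ i

theorem pref_length {X : Type*} (ξ : ℕ → X) (n : ℕ) : (pref ξ n).length = n := by
  simp [pref]

theorem pref_getElem {X : Type*} (ξ : ℕ → X) (n i : ℕ) (hi : i < (pref ξ n).length) :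
    (pref ξ n)[i] = ξ i := by
  simp [pref]

theorem pref_isPrefix {X : Type*} (ξ : ℕ → X) {m n : ℕ} (h : m ≤ n) : pref ξ m <+: pref ξ n := by
  rw [List.prefix_iff_eq_take]
  apply List.ext_getElem
  · simp [pref_length, h]
  · intro i h1 h2
    simp [pref_getElem]

theorem pref_injective {X : Type*} {ξ η : ℕ → X} (h : ∀ n, pref ξ n = pref η n) : ξ = η := by
  funext n
  have h1 : n < (pref ξ (n + 1)).length := by simp [pref_length]
  have h2 : n < (pref η (n + 1)).length := by simp [pref_length]
  rw [← pref_getElem ξ (n + 1) n h1, ← pref_getElem η (n + 1) n h2]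
  simp [h]

/-- The continuous extension of a tree automorphism to infinite sequences: the `n`-th letter of the
image of `ξ` is the last letter of the image of the prefix of length `n + 1` of `ξ`. -/
def boundaryFun {X : Type*} (g : TreeAut X) (ξ : ℕ → X) : ℕ → X := fun n =>
  ((g : Equiv.Perm (List X)) (pref ξ (n + 1)))[n]'(by rw [g.2.1, pref_length]; omega)

/-- The extension to the boundary is the one that is compatible with taking prefixes. -/
theorem pref_boundaryFun {X : Type*} (g : TreeAut X) (ξ : ℕ → X) (n : ℕ) :
    pref (boundaryFun g ξ) n = (g : Equiv.Perm (List X)) (pref ξ n) := by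
  apply List.ext_getElem
  · rw [pref_length, g.2.1, pref_length]
  · intro i h1 h2
    rw [pref_getElem]
    have hi : i + 1 ≤ n := by simpa [pref_length] using h1
    exact ((g.2.2 _ _).2 (pref_isPrefix ξ hi)).getElem _

/-- The action of the automorphism group of the tree on the boundary `X^ω`. -/
def boundaryAction (X : Type*) : TreeAut X →* Equiv.Perm (ℕ → X) :=
  MonoidHom.toHomPerm
    { toFun := boundaryFun
      map_one' := by
        funext ξ
        exact pref_injective fun n => by rw [pref_boundaryFun]; rfl
      map_mul' := by
        intro g h
        funext ξ
        exact pref_injective fun n => by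
          change _ = pref (boundaryFun g (boundaryFun h ξ)) n
          rw [pref_boundaryFun, pref_boundaryFun, pref_boundaryFun]; rfl }

theorem boundaryAction_apply {X : Type*} (g : TreeAut X) (ξ : ℕ → X) :
    boundaryAction X g ξ = boundaryFun g ξ := rfl

/-- A group `G` of tree automorphisms is self-similar if for all `g ∈ G` and every letter `x` the
section of `g` at `x` belongs to `G`: one has `g (x w) = y h(w)` for all words `w`, where `y` is a
letter and `h ∈ G`. -/
def IsSelfSimilar {X : Type*} (G : Subgroup (TreeAut X)) : Prop :=
  ∀ g ∈ G, ∀ x : X, ∃ y : X, ∃ h ∈ G, ∀ w : List X,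
    (g : Equiv.Perm (List X)) (x :: w) = y :: (h : Equiv.Perm (List X)) w

/-! ### Tree enveloping algebras -/

/-- The permutation representation of the automorphism group of the tree on the vector space
`k X^ω` with basis `X^ω`. -/
def boundaryRep (k X : Type*) [Field k] : TreeAut X →* Module.End k ((ℕ → X) →₀ k) where
  toFun g := Finsupp.lmapDomain k k (boundaryAction X g)
  map_one' := by
    rw [map_one]
    exact Finsupp.lmapDomain_id k k
  map_mul' g h := by
    rw [map_mul]
    apply Finsupp.lhom_ext
    intro ξ t
    simp [Module.End.mul_apply]

/-- The tree enveloping algebra of `G`: the image of the group algebra `k[G]` in `End (k X^ω)`. -/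
def treeEnvelopingAlgebra (k : Type*) [Field k] {X : Type*} (G : Subgroup (TreeAut X)) :
    Subalgebra k (Module.End k ((ℕ → X) →₀ k)) :=
  (MonoidAlgebra.lift k (Module.End k ((ℕ → X) →₀ k)) G
    ((boundaryRep k X).comp G.subtype)).range

instance (k : Type*) [Field k] {X : Type*} (G : Subgroup (TreeAut X)) :
    Ring (treeEnvelopingAlgebra k G) :=
  @Subalgebra.toRing k (Module.End k ((ℕ → X) →₀ k)) _ _ _ (treeEnvelopingAlgebra k G)

/-- The image in the tree enveloping algebra of an element of the group. -/
def ofGroup (k : Type*) [Field k] {X : Type*} (G : Subgroup (TreeAut X)) :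
    G →* treeEnvelopingAlgebra k G where
  toFun g := ⟨boundaryRep k X g, MonoidAlgebra.of k G g, by simp⟩
  map_one' := by ext1; simp
  map_mul' g h := by ext1; simp

/-- The sequence `xξ`. -/
def consSeq {X : Type*} (x : X) (ξ : ℕ → X) : ℕ → X
  | 0 => x
  | n + 1 => ξ n

theorem consSeq_injective {X : Type*} (x : X) : Function.Injective (consSeq x) := by
  intro ξ η h
  funext n
  exact congrFun h (n + 1)

theorem consSeq_head_tail {X : Type*} (ξ : ℕ → X) : consSeq (ξ 0) (fun n => ξ (n + 1)) = ξ := by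
  funext n
  cases n <;> rfl

theorem pref_consSeq {X : Type*} (x : X) (ξ : ℕ → X) (n : ℕ) :
    pref (consSeq x ξ) (n + 1) = x :: pref ξ n := by
  simp [pref, List.ofFn_succ, consSeq]

/-- The linear map `k X^ω → k X^ω` that sends each `ξ` to `xξ`. -/
def insertLetter (k : Type*) [Field k] {X : Type*} (x : X) :
    Module.End k ((ℕ → X) →₀ k) := Finsupp.lmapDomain k k (consSeq x)

/-- The linear map `k X^ω → k X^ω` that sends `xξ` to `ξ` for all `ξ`, and sends the sequences with
another first letter to zero. -/
def deleteLetter (k : Type*) [Field k] {X : Type*} (x : X) :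
    Module.End k ((ℕ → X) →₀ k) := Finsupp.lcomapDomain (consSeq x) (consSeq_injective x)

theorem insertLetter_single (k : Type*) [Field k] {X : Type*} (x : X) (ξ : ℕ → X) (t : k) :
    insertLetter k x (Finsupp.single ξ t) = Finsupp.single (consSeq x ξ) t := by
  simp [insertLetter]

theorem deleteLetter_single (k : Type*) [Field k] {X : Type*} [DecidableEq X] (x y : X)
    (ξ : ℕ → X) (t : k) :
    deleteLetter k x (Finsupp.single (consSeq y ξ) t) =
      if x = y then Finsupp.single ξ t else 0 := by
  ext η
  change Finsupp.single (consSeq y ξ) t (consSeq x η) = _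
  split_ifs with h
  · subst h
    classical
    rw [Finsupp.single_apply, Finsupp.single_apply]
    simp only [(consSeq_injective x).eq_iff]
  · rw [Finsupp.single_eq_of_ne]
    · rfl
    · intro h'
      exact h (congrFun h' 0)

theorem deleteLetter_insertLetter (k : Type*) [Field k] {X : Type*} [DecidableEq X] (x y : X) :
    deleteLetter k x * insertLetter k y = if x = y then 1 else 0 := by
  apply Finsupp.lhom_ext
  intro ξ t
  rw [Module.End.mul_apply, insertLetter_single, deleteLetter_single]
  split_ifs <;> simp

theorem sum_insertLetter_deleteLetter (k : Type*) [Field k] (X : Type*) [Fintype X]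
    [DecidableEq X] : ∑ x : X, insertLetter k x * deleteLetter k x = 1 := by
  apply Finsupp.lhom_ext
  intro ξ t
  rw [← consSeq_head_tail ξ, LinearMap.sum_apply]
  simp only [Module.End.mul_apply, deleteLetter_single]
  rw [Finset.sum_eq_single (ξ 0)]
  · simp [insertLetter_single]
  · intro b _ hb
    simp [hb]
  · simp

/-- The decomposition of the endomorphisms of `k X^ω` into matrices, according to
`X^ω = ⨆ x, x X^ω`: the `(x, y)` entry of `f` is the compositum
`k X^ω → k (y X^ω) → k X^ω → k (x X^ω) → k X^ω` of the insertion of `y`, of `f`, of the projection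
and of the deletion of `x`. -/
def endDecomposition (k X : Type*) [Field k] [Fintype X] [DecidableEq X] :
    Module.End k ((ℕ → X) →₀ k) →ₐ[k] Matrix X X (Module.End k ((ℕ → X) →₀ k)) :=
  AlgHom.ofLinearMap
    { toFun := fun f => Matrix.of fun x y => deleteLetter k x * f * insertLetter k y
      map_add' := fun f g => by
        ext1 x y
        simp [mul_add, add_mul]
      map_smul' := fun t f => by
        ext1 x y
        simp }
    (by
      ext1 x y
      simp [deleteLetter_insertLetter, Matrix.one_apply])
    (by
      intro f g
      ext1 x y
      simp only [LinearMap.coe_mk, AddHom.coe_mk, Matrix.of_apply, Matrix.mul_apply]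
      calc deleteLetter k x * (f * g) * insertLetter k y
          = deleteLetter k x * f * (∑ z : X, insertLetter k z * deleteLetter k z) * g *
              insertLetter k y := by
            rw [sum_insertLetter_deleteLetter]; simp [mul_assoc]
        _ = _ := by simp [Finset.mul_sum, Finset.sum_mul, mul_assoc])

theorem endDecomposition_apply (k : Type*) {X : Type*} [Field k] [Fintype X] [DecidableEq X]
    (f : Module.End k ((ℕ → X) →₀ k)) (x y : X) :
    endDecomposition k X f x y = deleteLetter k x * f * insertLetter k y := rfl

theorem endDecomposition_boundaryRep (k : Type*) {X : Type*} [Field k] [Fintype X] [DecidableEq X]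
    {g h : TreeAut X} {y z : X} (H : ∀ w : List X,
      (g : Equiv.Perm (List X)) (y :: w) = z :: (h : Equiv.Perm (List X)) w) (x : X) :
    endDecomposition k X (boundaryRep k X g) x y = if x = z then boundaryRep k X h else 0 := by
  have key : ∀ ξ, boundaryFun g (consSeq y ξ) = consSeq z (boundaryFun h ξ) := by
    intro ξ
    apply pref_injective
    intro n
    cases n with
    | zero => simp [pref]
    | succ n => rw [pref_boundaryFun, pref_consSeq, pref_consSeq, H, pref_boundaryFun]
  apply Finsupp.lhom_ext
  intro ξ t
  rw [endDecomposition_apply, Module.End.mul_apply, Module.End.mul_apply, insertLetter_single]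
  simp only [boundaryRep, MonoidHom.coe_mk, OneHom.coe_mk, Finsupp.lmapDomain_apply,
    Finsupp.mapDomain_single, boundaryAction_apply, key, deleteLetter_single]
  split_ifs <;> simp [boundaryAction_apply]

theorem endDecomposition_mem (k : Type*) {X : Type*} [Field k] [Fintype X] [DecidableEq X]
    {G : Subgroup (TreeAut X)} (hG : IsSelfSimilar G) (a : treeEnvelopingAlgebra k G) (x y : X) :
    endDecomposition k X a x y ∈ treeEnvelopingAlgebra k G := by
  obtain ⟨_, r, rfl⟩ := a
  induction r using MonoidAlgebra.induction_on with
  | of g =>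
    obtain ⟨z, h, hh, H⟩ := hG g g.2 y
    have : (MonoidAlgebra.lift k (Module.End k ((ℕ → X) →₀ k)) G
        ((boundaryRep k X).comp G.subtype)) (MonoidAlgebra.of k G g) = boundaryRep k X g := by
      simp
    simp only [AlgHom.toRingHom_eq_coe, RingHom.coe_coe, this]
    rw [endDecomposition_boundaryRep k H]
    split_ifs
    · exact (ofGroup k G ⟨h, hh⟩).2
    · exact zero_mem _
  | add r s hr hs =>
    simp only [AlgHom.toRingHom_eq_coe, RingHom.coe_coe, map_add, Matrix.add_apply] at hr hs ⊢
    exact add_mem hr hs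
  | smul t r hr =>
    simp only [AlgHom.toRingHom_eq_coe, RingHom.coe_coe, map_smul, Matrix.smul_apply] at hr ⊢
    exact Subalgebra.smul_mem _ hr t

/-- The decomposition `ψ : 𝔄 → M_X(𝔄)` of the tree enveloping algebra of a self-similar group; the
matrix entries are those of the decomposition of endomorphisms of `k X^ω`. -/
def decomposition (k : Type*) {X : Type*} [Field k] [Fintype X] [DecidableEq X]
    {G : Subgroup (TreeAut X)} (hG : IsSelfSimilar G) :
    treeEnvelopingAlgebra k G →ₐ[k] Matrix X X (treeEnvelopingAlgebra k G) :=
  AlgHom.ofLinearMap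
    { toFun := fun a => Matrix.of fun x y =>
        ⟨endDecomposition k X a x y, endDecomposition_mem k hG a x y⟩
      map_add' := fun a b => by
        ext1 x y
        apply Subtype.ext
        simp
      map_smul' := fun t a => by
        ext1 x y
        apply Subtype.ext
        simp }
    (by
      ext1 x y
      apply Subtype.ext
      simp only [LinearMap.coe_mk, AddHom.coe_mk, Matrix.of_apply, OneMemClass.coe_one, map_one,
        Matrix.one_apply]
      split_ifs <;> rfl)
    (by
      intro a b
      ext1 x y
      apply Subtype.ext
      simp [Matrix.mul_apply])

theorem coe_decomposition (k : Type*) {X : Type*} [Field k] [Fintype X] [DecidableEq X]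
    {G : Subgroup (TreeAut X)} (hG : IsSelfSimilar G) (a : treeEnvelopingAlgebra k G) (x y : X) :
    (decomposition k hG a x y : Module.End k ((ℕ → X) →₀ k)) = endDecomposition k X a x y := rfl

/-! ### Properties of algebras -/

/-- The underlying `k`-linear subspace of a two-sided ideal of a `k`-algebra. -/
def idealSubspace (k : Type*) {A : Type*} [Field k] [Ring A] [Algebra k A] (I : TwoSidedIdeal A) :
    Submodule k A := I.asIdeal.restrictScalars k

/-- An algebra `A` with a homomorphism `ψ : A → M_X(A)` is recurrent transitive if `ψ` is injective
and each of its matrix entries maps `A` onto `A`. -/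
def IsRecurrentTransitive {k A X : Type*} [Field k] [Ring A] [Algebra k A] [Fintype X]
    [DecidableEq X] (ψ : A →ₐ[k] Matrix X X A) : Prop :=
  Function.Injective ψ ∧ ∀ x y : X, Function.Surjective fun a => ψ a x y

/-- `K` is a finite-codimensional two-sided ideal with `M_X(K) ≤ ψ(K)`. -/
def IsFiniteCodimBranchingIdeal {k A X : Type*} [Field k] [Ring A] [Algebra k A] [Fintype X]
    [DecidableEq X] (ψ : A →ₐ[k] Matrix X X A) (K : TwoSidedIdeal A) : Prop :=
  (idealSubspace k K).CoFG ∧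
    (idealSubspace k K).matrix ≤ (idealSubspace k K).map ψ.toLinearMap

/-- A recurrent transitive algebra is regular branch if it has a two-sided ideal `K` of finite
codimension with `M_X(K) ≤ ψ(K)`. -/
def IsRegularBranch {k A X : Type*} [Field k] [Ring A] [Algebra k A] [Fintype X]
    [DecidableEq X] (ψ : A →ₐ[k] Matrix X X A) : Prop :=
  IsRecurrentTransitive ψ ∧ ∃ K : TwoSidedIdeal A, IsFiniteCodimBranchingIdeal ψ K

/-- A `k`-algebra is just-infinite if it is infinite-dimensional and all its non-zero two-sided
ideals have finite codimension. -/
def IsJustInfinite (k A : Type*) [Field k] [Ring A] [Algebra k A] : Prop :=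
  ¬ Module.Finite k A ∧ ∀ I : TwoSidedIdeal A, I ≠ ⊥ → (idealSubspace k I).CoFG

/-- A ring is prime if the product of any two non-zero two-sided ideals is non-zero. -/
def IsPrimeAlgebra (A : Type*) [Ring A] : Prop :=
  ∀ I J : TwoSidedIdeal A, I ≠ ⊥ → J ≠ ⊥ → ∃ x ∈ I, ∃ y ∈ J, x * y ≠ 0

/-! ### The Grigorchuk group and its tree enveloping algebra

The alphabet is `Fin 2`; the letters `0` and `1` are the first and the second letter. -/

/-- The generator `a` exchanges the two subtrees below the root. -/
def aFun : List (Fin 2) → List (Fin 2)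
  | [] => []
  | x :: w => Equiv.swap 0 1 x :: w

mutual
/-- The generator `b = ⟨a, c⟩`. -/
def bFun : List (Fin 2) → List (Fin 2)
  | [] => []
  | 0 :: w => 0 :: aFun w
  | 1 :: w => 1 :: cFun w

/-- The generator `c = ⟨a, d⟩`. -/
def cFun : List (Fin 2) → List (Fin 2)
  | [] => []
  | 0 :: w => 0 :: aFun w
  | 1 :: w => 1 :: dFun w

/-- The generator `d = ⟨1, b⟩`. -/
def dFun : List (Fin 2) → List (Fin 2)
  | [] => []
  | 0 :: w => 0 :: w
  | 1 :: w => 1 :: bFun w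
end

theorem aFun_involutive : Function.Involutive aFun := by
  intro w
  cases w <;> simp [aFun]

theorem bcdFun_involutive (w : List (Fin 2)) :
    bFun (bFun w) = w ∧ cFun (cFun w) = w ∧ dFun (dFun w) = w := by
  induction w with
  | nil => simp [bFun, cFun, dFun]
  | cons x w ih =>
    fin_cases x <;> simp [bFun, cFun, dFun, ih, aFun_involutive w]

theorem aFun_tree : (∀ w, (aFun w).length = w.length) ∧
    ∀ u v, aFun u <+: aFun v ↔ u <+: v := by
  refine ⟨fun w => by cases w <;> simp [aFun], fun u v => ?_⟩
  cases u <;> cases v <;> simp [aFun, List.cons_prefix_cons]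

theorem bcdFun_length (w : List (Fin 2)) :
    (bFun w).length = w.length ∧ (cFun w).length = w.length ∧ (dFun w).length = w.length := by
  induction w with
  | nil => simp [bFun, cFun, dFun]
  | cons x w ih =>
    fin_cases x <;> simp [bFun, cFun, dFun, ih, aFun_tree.1 w]

theorem bcdFun_prefix (u : List (Fin 2)) : ∀ v,
    (bFun u <+: bFun v ↔ u <+: v) ∧ (cFun u <+: cFun v ↔ u <+: v) ∧
      (dFun u <+: dFun v ↔ u <+: v) := by
  induction u with
  | nil => intro v; simp [bFun, cFun, dFun]
  | cons x u ih =>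
    intro v
    cases v with
    | nil => fin_cases x <;> simp [bFun, cFun, dFun]
    | cons y v =>
      fin_cases x <;> fin_cases y <;>
        simp [bFun, cFun, dFun, List.cons_prefix_cons, ih v, aFun_tree.2 u v]

/-- The generator `a`. -/
def aGen : TreeAut (Fin 2) := ⟨aFun_involutive.toPerm, aFun_tree⟩

/-- The generator `b`. -/
def bGen : TreeAut (Fin 2) :=
  ⟨Function.Involutive.toPerm bFun fun w => (bcdFun_involutive w).1,
    fun w => (bcdFun_length w).1, fun u v => (bcdFun_prefix u v).1⟩

/-- The generator `c`. -/
def cGen : TreeAut (Fin 2) :=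
  ⟨Function.Involutive.toPerm cFun fun w => (bcdFun_involutive w).2.1,
    fun w => (bcdFun_length w).2.1, fun u v => (bcdFun_prefix u v).2.1⟩

/-- The generator `d`. -/
def dGen : TreeAut (Fin 2) :=
  ⟨Function.Involutive.toPerm dFun fun w => (bcdFun_involutive w).2.2,
    fun w => (bcdFun_length w).2.2, fun u v => (bcdFun_prefix u v).2.2⟩

/-- The Grigorchuk group. -/
def grigorchukGroup : Subgroup (TreeAut (Fin 2)) := Subgroup.closure {aGen, bGen, cGen, dGen}

theorem aGen_mem : aGen ∈ grigorchukGroup := Subgroup.subset_closure (by simp)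
theorem bGen_mem : bGen ∈ grigorchukGroup := Subgroup.subset_closure (by simp)
theorem cGen_mem : cGen ∈ grigorchukGroup := Subgroup.subset_closure (by simp)
theorem dGen_mem : dGen ∈ grigorchukGroup := Subgroup.subset_closure (by simp)

theorem grigorchukGroup_isSelfSimilar : IsSelfSimilar grigorchukGroup := by
  intro g hg
  induction hg using Subgroup.closure_induction with
  | mem g hg =>
    intro x
    simp only [Set.mem_insert_iff, Set.mem_singleton_iff] at hg
    rcases hg with rfl | rfl | rfl | rfl
    · exact ⟨Equiv.swap 0 1 x, 1, one_mem _, fun w => rfl⟩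
    · fin_cases x
      · exact ⟨0, aGen, aGen_mem, fun w => rfl⟩
      · exact ⟨1, cGen, cGen_mem, fun w => rfl⟩
    · fin_cases x
      · exact ⟨0, aGen, aGen_mem, fun w => rfl⟩
      · exact ⟨1, dGen, dGen_mem, fun w => rfl⟩
    · fin_cases x
      · exact ⟨0, 1, one_mem _, fun w => rfl⟩
      · exact ⟨1, bGen, bGen_mem, fun w => rfl⟩
  | one => exact fun x => ⟨x, 1, one_mem _, fun w => rfl⟩
  | mul g₁ g₂ _ _ h₁ h₂ =>
    intro x
    obtain ⟨y, s, hs, H⟩ := h₂ x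
    obtain ⟨z, t, ht, H'⟩ := h₁ y
    exact ⟨z, t * s, mul_mem ht hs, fun w => by simp [H, H']⟩
  | inv g _ h =>
    intro x
    have hy : ∃ y, ((g⁻¹ : TreeAut (Fin 2)) : Equiv.Perm (List (Fin 2))) [x] = [y] :=
      List.length_eq_one_iff.1 ((g⁻¹).2.1 [x])
    obtain ⟨y, hy⟩ := hy
    obtain ⟨z, s, hs, H⟩ := h y
    have hz : z = x := by
      have h1 := H []
      rw [← hy] at h1
      have h2 : (s : Equiv.Perm (List (Fin 2))) [] = [] :=
        List.length_eq_zero_iff.1 (s.2.1 [])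
      rw [h2] at h1
      simpa using h1.symm
    subst hz
    refine ⟨y, s⁻¹, inv_mem hs, fun w => ?_⟩
    have h3 := H (((s⁻¹ : TreeAut (Fin 2)) : Equiv.Perm (List (Fin 2))) w)
    have h4 : (s : Equiv.Perm (List (Fin 2)))
        (((s⁻¹ : TreeAut (Fin 2)) : Equiv.Perm (List (Fin 2))) w) = w :=
      Equiv.apply_symm_apply (s : Equiv.Perm (List (Fin 2))) w
    rw [h4] at h3
    rw [← h3]
    exact Equiv.symm_apply_apply (g : Equiv.Perm (List (Fin 2))) _

/-- The tree enveloping algebra `𝔄` of the Grigorchuk group over the field `k`. -/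
abbrev grigorchukAlgebra (k : Type*) [Field k] :
    Subalgebra k (Module.End k ((ℕ → Fin 2) →₀ k)) :=
  treeEnvelopingAlgebra k grigorchukGroup

/-- The decomposition `ψ : 𝔄 → M₂(𝔄)`. -/
def grigorchukDecomposition (k : Type*) [Field k] :
    grigorchukAlgebra k →ₐ[k] Matrix (Fin 2) (Fin 2) (grigorchukAlgebra k) :=
  decomposition k grigorchukGroup_isSelfSimilar

/-- The branching subgroup of the Grigorchuk group: the normal closure of the commutator
`[a, b] = a⁻¹ b⁻¹ a b`. -/
def grigorchukBranchingSubgroup : Subgroup grigorchukGroup :=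
  let a : grigorchukGroup := ⟨aGen, aGen_mem⟩
  let b : grigorchukGroup := ⟨bGen, bGen_mem⟩
  Subgroup.normalClosure {a⁻¹ * b⁻¹ * a * b}

/-- The branching ideal `𝔎` of `𝔄`: the two-sided ideal generated by the elements `h - 1`, where
`h` runs through the branching subgroup. -/
def grigorchukBranchingIdeal (k : Type*) [Field k] : TwoSidedIdeal (grigorchukAlgebra k) :=
  TwoSidedIdeal.span
    {x | ∃ h ∈ grigorchukBranchingSubgroup, x = ofGroup k grigorchukGroup h - 1}

end TreeAlgebra

end

noncomputable section

namespace TreeAlgebra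

-- Subspaces of finite codimension

section Codimension

variable {k V W : Type*} [Field k] [AddCommGroup V] [Module k V] [AddCommGroup W] [Module k W]

-- Write `A` for the algebra, `K` for the branching ideal, `t = [a, b]`, and `pull P` for the space
-- of elements all of whose matrix entries lie in `P`.
--
-- Branching. `K = A (t - 1) A`, and it has finite codimension because the group modulo the
-- branching subgroup is finite. The element `s = [t, d]` of that subgroup is trivial on the first
-- subtree and equals `c t c` on the second. Multiplying `s - 1` by lifts of arbitrary elements
-- therefore puts any element of `K` in any single matrix position, with a preimage in `K`
-- (`exists_single_lift`). This gives `M₂(K) ≤ ψ(K)` and, by injectivity of `ψ`, `pull K ≤ K`.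
-- Infinite dimension follows: `ψ⁻¹` of the matrices supported in one corner with entry in `K` is a
-- proper subspace of `K` of the same dimension as `K`.
--
-- Spreading. Let `L` be the `n`-th iterate of `pull` on `K`. Every non-zero `x` satisfies `L L ≤ L
-- x L` for some `n` (`exists_spreadsAt`). The property passes from a matrix entry of `x` to `x`, at
-- the cost of one more level (`SpreadsAt.of_entry`), and it holds for non-zero scalars at level
-- zero. By contraction, iterated entries of any element fall into the span of `1, a, b, c, d`. A
-- non-zero combination of these reaches a non-zero scalar after finitely many further
-- decompositions. The only candidates for exceptions are multiples of `1 + b + c + d` in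
-- characteristic two, where this sum is zero on the boundary.
--
-- Conclusion. Every non-zero ideal contains some `L L`. Since `K` is generated by one element, all
-- its powers have finite codimension (`coFG_pow`). Products of iterated preimages contain the
-- iterated preimage of the product (`iterate_pull_mul_ge`), so `L L` has finite codimension: the
-- algebra is just-infinite. If two non-zero ideals had zero product, then `L⁴ = 0` for a common
-- `L`. But `L⁴` has finite codimension too, contradicting infinite dimension.

theorem coFG_comap (f : V →ₗ[k] W) {P : Submodule k W} (hP : P.CoFG) : (P.comap f).CoFG := by
  have : P.comap f = LinearMap.ker (P.mkQ ∘ₗ f) := by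
    rw [LinearMap.ker_comp, Submodule.ker_mkQ]
  rw [this]
  have : Module.Finite k (W ⧸ P) := hP
  exact Submodule.CoFG.ker _

theorem coFG_matrix {n : Type*} [Finite n] {P : Submodule k V} (hP : P.CoFG) :
    (P.matrix : Submodule k (Matrix n n V)).CoFG := by
  have : Module.Finite k (V ⧸ P) := hP
  have h : (P.matrix : Submodule k (Matrix n n V)) = LinearMap.ker (P.mkQ.mapMatrix) := by
    ext M
    rw [LinearMap.mem_ker, ← Matrix.ext_iff]
    simp only [LinearMap.mapMatrix_apply, Matrix.map_apply, Matrix.zero_apply, Submodule.mkQ_apply,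
      Submodule.Quotient.mk_eq_zero]
    rfl
  rw [h]
  have := Fintype.ofFinite n
  exact Submodule.CoFG.ker _

theorem exists_fg_sup_eq_top {P : Submodule k V} (hP : P.CoFG) :
    ∃ F : Submodule k V, F.FG ∧ F ⊔ P = ⊤ := by
  obtain ⟨F, hF⟩ := exists_isCompl P
  exact ⟨F, Submodule.CoFG.fg_of_isCompl hF hP, hF.symm.sup_eq_top⟩

theorem coFG_of_fg_sup_eq_top {F P : Submodule k V} (hF : F.FG) (h : F ⊔ P = ⊤) : P.CoFG :=
  Submodule.FG.cofg_of_codisjoint (codisjoint_iff.2 h) hF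

end Codimension

-- Powers of ideals of finite codimension

section Powers

variable {k A : Type*} [Field k] [Ring A] [Algebra k A]

/-- All powers of a finite-codimensional two-sided ideal generated by a finite-dimensional subspace
have finite codimension. -/
theorem coFG_pow {I T : Submodule k A} (hI : I.CoFG) (hT : T.FG) (hTI : T ≤ I)
    (hIT : I = ⊤ * T * ⊤) (n : ℕ) : (I ^ (n + 1)).CoFG := by
  obtain ⟨F, hF, hFI⟩ := exists_fg_sup_eq_top hI
  have hl : ⊤ * I = I := by
    rw [hIT, ← mul_assoc, ← mul_assoc]
    congr 2
    exact le_antisymm le_top (le_trans (by rw [one_mul]) (mul_le_mul_left le_top ⊤))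
  have hr : I * ⊤ = I := by
    rw [hIT, mul_assoc]
    congr 1
    exact le_antisymm le_top (le_trans (by rw [one_mul]) (mul_le_mul_left le_top ⊤))
  have hII : I * I ≤ I := by
    conv_rhs => rw [← hl]
    exact mul_le_mul_left le_top _
  -- Expand `I = (F + I) T (F + I)` with `F` a finite-dimensional supplement of `I`. Every term
  -- other than `F T F` has two factors in `I`, because `T ≤ I`.
  have h1 : I = F * T * F ⊔ I * I := by
    apply le_antisymm
    · have h2 : T * I ≤ I * I := mul_le_mul_left hTI I
      have h3 : F * T * I ≤ I * I := by
        rw [mul_assoc]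
        calc F * (T * I) ≤ ⊤ * (I * I) := mul_le_mul' le_top h2
          _ = I * I := by rw [← mul_assoc, hl]
      have h4 : I * T * F ≤ I * I := by
        calc I * T * F ≤ I * I * ⊤ := mul_le_mul' (mul_le_mul_right hTI I) le_top
          _ = I * I := by rw [mul_assoc, hr]
      have h5 : I * T * I ≤ I * I := by
        calc I * T * I ≤ I * I * ⊤ := mul_le_mul' (mul_le_mul_right hTI I) le_top
          _ = I * I := by rw [mul_assoc, hr]
      calc I = (F ⊔ I) * T * (F ⊔ I) := by rw [hFI, ← hIT]
        _ = (F * T * F ⊔ I * T * F) ⊔ (F * T * I ⊔ I * T * I) := by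
          rw [Submodule.sup_mul, Submodule.mul_sup, Submodule.sup_mul, Submodule.sup_mul]
        _ ≤ F * T * F ⊔ I * I :=
          sup_le (sup_le_sup_left h4 _) (sup_le (h3.trans le_sup_right) (h5.trans le_sup_right))
    · refine sup_le ?_ hII
      calc F * T * F ≤ ⊤ * T * ⊤ := mul_le_mul' (mul_le_mul_left le_top T) le_top
        _ = I := hIT.symm
  -- Consecutive powers differ by a finite-dimensional space: if `G` spans one layer modulo the
  -- next, then `G (F T F)` spans the next layer.
  have h2 : ∀ n, ∃ G : Submodule k A, G.FG ∧ G ⊔ I ^ (n + 1 + 1) = I ^ (n + 1) := by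
    intro n
    induction n with
    | zero => exact ⟨_, (hF.mul hT).mul hF, by rw [pow_succ, zero_add, pow_one, ← h1]⟩
    | succ n ih =>
      obtain ⟨G, hG, h⟩ := ih
      set P := I ^ (n + 1) with hP
      have hGP : G ≤ P := by rw [← h]; exact le_sup_left
      refine ⟨G * (F * T * F), hG.mul ((hF.mul hT).mul hF), ?_⟩
      have e1 : I ^ (n + 1 + 1) = P * I := pow_succ _ _
      have e2 : I ^ (n + 1 + 1 + 1) = P * I * I := by rw [pow_succ, e1]
      rw [e1] at h
      rw [e1, e2]
      apply le_antisymm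
      · refine sup_le ?_ ?_
        · refine mul_le_mul' hGP ?_
          conv_rhs => rw [h1]
          exact le_sup_left
        · rw [mul_assoc]
          exact mul_le_mul_right hII P
      · calc P * I = (G ⊔ P * I) * I := by rw [h]
          _ = G * (F * T * F ⊔ I * I) ⊔ P * I * I := by rw [Submodule.sup_mul, ← h1]
          _ = G * (F * T * F) ⊔ G * (I * I) ⊔ P * I * I := by rw [Submodule.mul_sup]
          _ ≤ _ := by
            refine sup_le (sup_le le_sup_left (le_sup_of_le_right ?_)) le_sup_right
            rw [← mul_assoc]
            exact mul_le_mul_left (mul_le_mul_left hGP I) I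
  have h3 : ∃ G : Submodule k A, G.FG ∧ G ⊔ I ^ (n + 1) = ⊤ := by
    induction n with
    | zero => exact ⟨F, hF, by rw [zero_add, pow_one, hFI]⟩
    | succ n ih =>
      obtain ⟨G, hG, h⟩ := ih
      obtain ⟨G', hG', h'⟩ := h2 n
      exact ⟨G ⊔ G', hG.sup hG', by rw [sup_assoc, h', h]⟩
  obtain ⟨G, hG, h⟩ := h3
  exact coFG_of_fg_sup_eq_top hG h

end Powers

-- Iterated preimages of matrix subspaces

section Pull

variable {k A X : Type*} [Field k] [Ring A] [Algebra k A] [Fintype X] [DecidableEq X]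

/-- The preimage under `ψ : A → M_X(A)` of the matrices with entries in `P`. -/
def pull (ψ : A →ₐ[k] Matrix X X A) (P : Submodule k A) : Submodule k A :=
  P.matrix.comap ψ.toLinearMap

variable {ψ : A →ₐ[k] Matrix X X A}

theorem mem_pull {P : Submodule k A} {a : A} : a ∈ pull ψ P ↔ ∀ i j, ψ a i j ∈ P := Iff.rfl

theorem pull_mono {P Q : Submodule k A} (h : P ≤ Q) : pull ψ P ≤ pull ψ Q :=
  fun _ ha i j => h (ha i j)

theorem iterate_pull_mono {P Q : Submodule k A} (h : P ≤ Q) (n : ℕ) :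
    (pull ψ)^[n] P ≤ (pull ψ)^[n] Q :=
  Monotone.iterate (f := pull ψ) (fun _ _ => pull_mono) n h

theorem iterate_pull_le {P : Submodule k A} (h : pull ψ P ≤ P) {m n : ℕ} (hmn : m ≤ n) :
    (pull ψ)^[n] P ≤ (pull ψ)^[m] P := by
  induction n, hmn using Nat.le_induction with
  | base => exact le_rfl
  | succ n _ ih => exact (iterate_pull_mono h n).trans ih

theorem le_iterate_pull {P : Submodule k A} (h : P ≤ pull ψ P) {m n : ℕ} (hmn : m ≤ n) :
    (pull ψ)^[m] P ≤ (pull ψ)^[n] P := by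
  induction n, hmn using Nat.le_induction with
  | base => exact le_rfl
  | succ n _ ih => exact ih.trans (iterate_pull_mono h n)

theorem pull_coFG {P : Submodule k A} (h : P.CoFG) : (pull ψ P).CoFG :=
  coFG_comap _ (coFG_matrix h)

theorem iterate_pull_coFG {P : Submodule k A} (h : P.CoFG) (n : ℕ) :
    ((pull ψ)^[n] P).CoFG := by
  induction n with
  | zero => exact h
  | succ n ih => rw [Function.iterate_succ_apply']; exact pull_coFG ih

theorem pull_mul_le (P Q : Submodule k A) : pull ψ P * pull ψ Q ≤ pull ψ (P * Q) := by
  rw [Submodule.mul_le]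
  intro p hp q hq i j
  change ψ (p * q) i j ∈ _
  rw [map_mul, Matrix.mul_apply]
  exact Submodule.sum_mem _ fun z _ => Submodule.mul_mem_mul (hp i z) (hq z j)

theorem iterate_pull_mul_le (P Q : Submodule k A) (n : ℕ) :
    (pull ψ)^[n] P * (pull ψ)^[n] Q ≤ (pull ψ)^[n] (P * Q) := by
  induction n with
  | zero => exact le_rfl
  | succ n ih =>
    simp only [Function.iterate_succ_apply']
    exact (pull_mul_le _ _).trans (pull_mono ih)

/-- Elementary matrices with entries in `P` have preimages in `pull ψ P`. -/
def Liftable (ψ : A →ₐ[k] Matrix X X A) (P : Submodule k A) : Prop :=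
  ∀ p ∈ P, ∀ i j, ∃ u ∈ pull ψ P, ψ u = Matrix.single i j p

/-- The lift given by `Q` already has its only possibly non-zero entry in `P`. -/
theorem Liftable.of_le {P Q : Submodule k A} (hQ : Liftable ψ Q) (h : P ≤ Q) : Liftable ψ P := by
  intro p hp i j
  obtain ⟨u, -, hu⟩ := hQ p (h hp) i j
  refine ⟨u, fun i' j' => ?_, hu⟩
  change ψ u i' j' ∈ P
  rw [hu, Matrix.single_apply]
  split_ifs
  · exact hp
  · exact zero_mem _

theorem mem_of_forall_single (hψ : Function.Injective ψ) {S : Submodule k A} {x : A}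
    (h : ∀ i j, ∃ u ∈ S, ψ u = Matrix.single i j (ψ x i j)) : x ∈ S := by
  choose u hu h using h
  have : x = ∑ i, ∑ j, u i j := by
    apply hψ
    rw [Matrix.matrix_eq_sum_single (ψ x)]
    simp only [map_sum, h]
  rw [this]
  exact Submodule.sum_mem _ fun i _ => Submodule.sum_mem _ fun j _ => hu i j

/-- An elementary matrix with entry `p q` is the product of elementary matrices with entries `p` and
`q`, both of which lift. Injectivity of `ψ` then recovers an element from the lifts of its entries.
-/
theorem pull_mul_ge (hψ : Function.Injective ψ) {P Q : Submodule k A}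
    (hP : Liftable ψ P) (hQ : Liftable ψ Q) : pull ψ (P * Q) ≤ pull ψ P * pull ψ Q := by
  have key : ∀ i j, ∀ x ∈ P * Q, ∃ u ∈ pull ψ P * pull ψ Q, ψ u = Matrix.single i j x := by
    intro i j x hx
    induction hx using Submodule.mul_induction_on' with
    | mem_mul_mem p hp q hq =>
      obtain ⟨u, hu, hu'⟩ := hP p hp i i
      obtain ⟨v, hv, hv'⟩ := hQ q hq i j
      exact ⟨u * v, Submodule.mul_mem_mul hu hv, by rw [map_mul, hu', hv']; simp⟩
    | add x _ y _ hx hy =>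
      obtain ⟨u, hu, hu'⟩ := hx
      obtain ⟨v, hv, hv'⟩ := hy
      exact ⟨u + v, add_mem hu hv, by rw [map_add, hu', hv', Matrix.single_add]⟩
  intro x hx
  exact mem_of_forall_single hψ fun i j => key i j _ (hx i j)

/-- The condition `pull ψ K ≤ K` keeps all iterates inside `K`, so they stay liftable and
`pull_mul_ge` applies at each level. -/
theorem iterate_pull_mul_ge (hψ : Function.Injective ψ) {K P Q : Submodule k A}
    (hK : Liftable ψ K) (hKK : pull ψ K ≤ K) (hP : P ≤ K) (hQ : Q ≤ K) (n : ℕ) :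
    (pull ψ)^[n] (P * Q) ≤ (pull ψ)^[n] P * (pull ψ)^[n] Q := by
  induction n with
  | zero => exact le_rfl
  | succ n ih =>
    have h : ∀ {R}, R ≤ K → Liftable ψ ((pull ψ)^[n] R) := fun hR =>
      hK.of_le ((iterate_pull_mono hR n).trans (iterate_pull_le hKK (Nat.zero_le n)))
    simp only [Function.iterate_succ_apply']
    exact (pull_mono ih).trans (pull_mul_ge hψ (h hP) (h hQ))

-- Spreading from matrix entries to elements

/-- `L L ≤ L x L`, where `L` is the `n`-th iterated preimage of `K`. -/
def SpreadsAt (ψ : A →ₐ[k] Matrix X X A) (K : Submodule k A) (n : ℕ) (x : A) : Prop :=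
  (pull ψ)^[n] K * (pull ψ)^[n] K ≤ (pull ψ)^[n] K * (Submodule.span k {x}) * (pull ψ)^[n] K

theorem spreadsAt_algebraMap (K : Submodule k A) {t : k} (ht : t ≠ 0) :
    SpreadsAt ψ K 0 (algebraMap k A t) := by
  have : (1 : Submodule k A) ≤ Submodule.span k {algebraMap k A t} := by
    rw [Submodule.one_le]
    refine Submodule.mem_span_singleton.2 ⟨t⁻¹, ?_⟩
    rw [Algebra.smul_def, ← map_mul, inv_mul_cancel₀ ht, map_one]
  change K * K ≤ K * (Submodule.span k {algebraMap k A t}) * K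
  calc K * K = K * 1 * K := by rw [mul_one]
    _ ≤ _ := mul_le_mul_left (mul_le_mul_right this K) K

/-- If `u` lifts `p` in position `(i', i)` and `v` lifts `q` in position `(j, j')`, then `u x v`
lifts `p (ψ x i j) q` in position `(i', j')`. Thus one entry of `x` controls all positions. -/
theorem SpreadsAt.of_entry (hψ : Function.Injective ψ) {K : Submodule k A}
    (hK : Liftable ψ K) (hKK : pull ψ K ≤ K) {n : ℕ} {x : A} {i j : X}
    (h : SpreadsAt ψ K n (ψ x i j)) : SpreadsAt ψ K (n + 1) x := by
  have hL : Liftable ψ ((pull ψ)^[n] K) := hK.of_le (iterate_pull_le hKK (Nat.zero_le n))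
  unfold SpreadsAt at h ⊢
  simp only [Function.iterate_succ_apply']
  set L := (pull ψ)^[n] K
  have key : ∀ i' j', ∀ y ∈ L * (Submodule.span k {ψ x i j}) * L,
      ∃ u ∈ pull ψ L * (Submodule.span k {x}) * pull ψ L, ψ u = Matrix.single i' j' y := by
    intro i' j' y hy
    induction hy using Submodule.mul_induction_on' with
    | mem_mul_mem p hp q hq =>
      obtain ⟨p, hpL, rfl⟩ := Submodule.mem_mul_span_singleton.1 hp
      obtain ⟨u, hu, hu'⟩ := hL p hpL i' i
      obtain ⟨v, hv, hv'⟩ := hL q hq j j'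
      refine ⟨u * x * v, Submodule.mul_mem_mul
        (Submodule.mul_mem_mul hu (Submodule.mem_span_singleton_self x)) hv, ?_⟩
      rw [map_mul, map_mul, hu', hv', Matrix.single_mul_mul_single]
    | add x _ y _ hx hy =>
      obtain ⟨u, hu, hu'⟩ := hx
      obtain ⟨v, hv, hv'⟩ := hy
      exact ⟨u + v, add_mem hu hv, by rw [map_add, hu', hv', Matrix.single_add]⟩
  intro y hy
  exact mem_of_forall_single hψ fun i' j' => key i' j' _ (h (pull_mul_le L L hy i' j'))

theorem SpreadsAt.le_of_mem {K : Submodule k A} {n : ℕ} {x : A} (h : SpreadsAt ψ K n x)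
    {I : TwoSidedIdeal A} (hx : x ∈ I) :
    (pull ψ)^[n] K * (pull ψ)^[n] K ≤ idealSubspace k I := by
  refine h.trans ?_
  rw [Submodule.mul_le]
  intro p hp q _
  obtain ⟨p, -, rfl⟩ := Submodule.mem_mul_span_singleton.1 hp
  exact TwoSidedIdeal.mem_asIdeal.2 (I.mul_mem_right _ _ (I.mul_mem_left _ _ hx))

end Pull

-- The Grigorchuk group: relations and the finite quotient by the branching subgroup

theorem bcdFun_mul (w : List (Fin 2)) :
    (bFun (cFun w) = dFun w ∧ cFun (dFun w) = bFun w ∧ dFun (bFun w) = cFun w) ∧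
    (cFun (bFun w) = dFun w ∧ dFun (cFun w) = bFun w ∧ bFun (dFun w) = cFun w) := by
  induction w with
  | nil => simp [bFun, cFun, dFun]
  | cons x w ih =>
    fin_cases x <;> simp [bFun, cFun, dFun, ih, aFun_involutive w]

namespace Grigorchuk

/-- The generator `a` as an element of the Grigorchuk group. -/
def a : grigorchukGroup := ⟨aGen, aGen_mem⟩
/-- The generator `b` as an element of the Grigorchuk group. -/
def b : grigorchukGroup := ⟨bGen, bGen_mem⟩
/-- The generator `c` as an element of the Grigorchuk group. -/
def c : grigorchukGroup := ⟨cGen, cGen_mem⟩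
/-- The generator `d` as an element of the Grigorchuk group. -/
def d : grigorchukGroup := ⟨dGen, dGen_mem⟩

theorem ext_apply {g h : grigorchukGroup}
    (H : ∀ w, ((g : TreeAut (Fin 2)) : Equiv.Perm (List (Fin 2))) w =
      ((h : TreeAut (Fin 2)) : Equiv.Perm (List (Fin 2))) w) : g = h :=
  Subtype.ext (Subtype.ext (Equiv.ext H))

theorem a_mul_a : a * a = 1 := ext_apply fun w => aFun_involutive w
theorem b_mul_b : b * b = 1 := ext_apply fun w => (bcdFun_involutive w).1
theorem c_mul_c : c * c = 1 := ext_apply fun w => (bcdFun_involutive w).2.1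
theorem d_mul_d : d * d = 1 := ext_apply fun w => (bcdFun_involutive w).2.2
theorem b_mul_c : b * c = d := ext_apply fun w => (bcdFun_mul w).1.1
theorem c_mul_d : c * d = b := ext_apply fun w => (bcdFun_mul w).1.2.1
theorem d_mul_b : d * b = c := ext_apply fun w => (bcdFun_mul w).1.2.2
theorem c_mul_b : c * b = d := ext_apply fun w => (bcdFun_mul w).2.1
theorem d_mul_c : d * c = b := ext_apply fun w => (bcdFun_mul w).2.2.1
theorem b_mul_d : b * d = c := ext_apply fun w => (bcdFun_mul w).2.2.2

/-- The square of `a d` fixes the first level and acts as the involution `b` on both subtrees. -/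
theorem a_mul_d_pow_four : (a * d) ^ 4 = 1 := by
  apply ext_apply
  intro w
  change aFun (dFun (aFun (dFun (aFun (dFun (aFun (dFun w))))))) = w
  match w with
  | [] => simp [aFun, dFun]
  | x :: w => fin_cases x <;> simp [aFun, dFun, bcdFun_involutive w]

theorem induction_left {p : grigorchukGroup → Prop} (one : p 1) (ha : ∀ g, p g → p (a * g))
    (hb : ∀ g, p g → p (b * g)) (hc : ∀ g, p g → p (c * g)) (hd : ∀ g, p g → p (d * g))
    (g : grigorchukGroup) : p g := by
  obtain ⟨g, hg⟩ := g
  induction hg using Subgroup.closure_induction_left with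
  | one => exact one
  | mul_left x hx y hy ih =>
    simp only [Set.mem_insert_iff, Set.mem_singleton_iff] at hx
    rcases hx with rfl | rfl | rfl | rfl
    exacts [ha _ ih, hb _ ih, hc _ ih, hd _ ih]
  -- The generators are built from involutions, so each is its own inverse by definitional
  -- unfolding.
  | inv_mul_cancel x hx y hy ih =>
    simp only [Set.mem_insert_iff, Set.mem_singleton_iff] at hx
    rcases hx with rfl | rfl | rfl | rfl
    · exact ha _ ih
    · exact hb _ ih
    · exact hc _ ih
    · exact hd _ ih

/-- The commutator `[a, b]`. -/
def t : grigorchukGroup := a⁻¹ * b⁻¹ * a * b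

theorem inv_a : a⁻¹ = a := inv_eq_of_mul_eq_one_left a_mul_a
theorem inv_b : b⁻¹ = b := inv_eq_of_mul_eq_one_left b_mul_b
theorem inv_d : d⁻¹ = d := inv_eq_of_mul_eq_one_left d_mul_d

theorem t_eq : t = a * b * a * b := by rw [t, inv_a, inv_b]

theorem branchingSubgroup_eq : grigorchukBranchingSubgroup = Subgroup.normalClosure {t} := rfl

instance : grigorchukBranchingSubgroup.Normal := Subgroup.normalClosure_normal

theorem t_mem : t ∈ grigorchukBranchingSubgroup :=
  Subgroup.subset_normalClosure (Set.mem_singleton t)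

/-- The commutator `[t, d]`; it acts trivially on the first subtree. -/
def s : grigorchukGroup := t⁻¹ * (d * t * d)

theorem s_mem : s ∈ grigorchukBranchingSubgroup := by
  refine mul_mem (inv_mem t_mem) ?_
  have := (inferInstance : grigorchukBranchingSubgroup.Normal).conj_mem t t_mem d
  rwa [inv_d] at this

theorem s_eq : s = b * a * b * a * (d * (a * b * a * b) * d) := by
  rw [s, t_eq]
  simp only [mul_inv_rev, inv_a, inv_b, mul_assoc]

/-- In the quotient `b` commutes with `a`, and it always commutes with `d`, while `c = b d`. So the
quotient is generated by a central involution `b` and a dihedral image of `⟨a, d⟩`, finite because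
`(a d) ^ 4 = 1`. -/
theorem finite_quotient : Finite (grigorchukGroup ⧸ grigorchukBranchingSubgroup) := by
  let π := QuotientGroup.mk' grigorchukBranchingSubgroup
  have hab : π b * π a = π a * π b := by
    have h : π t = 1 := (QuotientGroup.eq_one_iff t).2 t_mem
    rw [t, map_mul, map_mul, map_mul, map_inv, map_inv, mul_assoc, ← mul_inv_rev, inv_mul_eq_one]
      at h
    exact h
  have haa : π a * π a = 1 := by rw [← map_mul, a_mul_a, map_one]
  have hbb : π b * π b = 1 := by rw [← map_mul, b_mul_b, map_one]
  have hbd : π b * π d = π d * π b := by rw [← map_mul, ← map_mul, b_mul_d, d_mul_b]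
  have hda : π d = π a * (π a * π d) := by rw [← mul_assoc, haa, one_mul]
  have hc : π c = π b * π d := by rw [← map_mul, b_mul_d]
  have hr : (π a * π d) ^ 4 = 1 := by rw [← map_mul, ← map_pow, a_mul_d_pow_four, map_one]
  have har : ∀ i : ℤ, π a * (π a * π d) ^ i = (π a * π d) ^ (-i) * π a := by
    intro i
    have hdd : π d * π d = 1 := by rw [← map_mul, d_mul_d, map_one]
    have hi : (π a * π d)⁻¹ = π a * (π a * π d) * (π a)⁻¹ := by
      rw [inv_eq_iff_mul_eq_one, eq_inv_of_mul_eq_one_left haa]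
      simp only [inv_inv]
      rw [inv_eq_of_mul_eq_one_left haa]
      calc π a * π d * (π a * (π a * π d) * π a) = π a * π d * (π a * π a) * π d * π a := by
            simp only [mul_assoc]
        _ = π a * (π d * π d) * π a := by rw [haa]; simp only [mul_assoc, one_mul]
        _ = 1 := by rw [hdd, mul_one, haa]
    rw [zpow_neg, ← inv_zpow, hi, conj_zpow, inv_mul_cancel_right]
  have hbr : ∀ i : ℤ, π b * (π a * π d) ^ i = (π a * π d) ^ i * π b := fun i =>
    (Commute.mul_right (hab : Commute (π b) (π a)) (hbd : Commute (π b) (π d))).zpow_right i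
  -- Normal forms. Stability under left multiplication by the generators shows that they exhaust the
  -- quotient. Integer exponents avoid reductions; finiteness comes afterwards from the orders.
  let T : Set (grigorchukGroup ⧸ grigorchukBranchingSubgroup) :=
    {x | ∃ i e f : ℤ, x = (π a * π d) ^ i * π a ^ e * π b ^ f}
  have hTa : ∀ x ∈ T, π a * x ∈ T := by
    rintro _ ⟨i, e, f, rfl⟩
    refine ⟨-i, e + 1, f, ?_⟩
    rw [← mul_assoc, ← mul_assoc, har, add_comm, zpow_add, zpow_one]
    simp only [mul_assoc]
  have hTr : ∀ x ∈ T, (π a * π d) * x ∈ T := by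
    rintro _ ⟨i, e, f, rfl⟩
    refine ⟨1 + i, e, f, ?_⟩
    rw [zpow_add, zpow_one]
    simp only [mul_assoc]
  have hTb : ∀ x ∈ T, π b * x ∈ T := by
    rintro _ ⟨i, e, f, rfl⟩
    refine ⟨i, e, 1 + f, ?_⟩
    have h : π b * π a ^ e = π a ^ e * π b := Commute.zpow_right hab e
    rw [zpow_add, zpow_one, ← mul_assoc, ← mul_assoc, hbr, mul_assoc _ (π b), h]
    simp only [mul_assoc]
  have hTd : ∀ x ∈ T, π d * x ∈ T := by
    intro x hx
    rw [hda, mul_assoc]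
    exact hTa _ (hTr _ hx)
  have hT : ∀ g, π g ∈ T := by
    intro g
    induction g using induction_left with
    | one => exact ⟨0, 0, 0, by simp⟩
    | ha g ih => rw [map_mul]; exact hTa _ ih
    | hb g ih => rw [map_mul]; exact hTb _ ih
    | hc g ih => rw [map_mul, hc, mul_assoc]; exact hTb _ (hTd _ ih)
    | hd g ih => rw [map_mul]; exact hTd _ ih
  have hfin : ∀ {x : grigorchukGroup ⧸ grigorchukBranchingSubgroup} {n : ℕ}, 0 < n → x ^ n = 1 →
      (Set.range fun i : ℤ => x ^ i).Finite := by
    intro x n hn hx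
    have := (isOfFinOrder_iff_pow_eq_one.2 ⟨n, hn, hx⟩).finite_zpowers
    exact this
  have hTfin : T.Finite := by
    refine (((hfin four_pos hr).mul (hfin two_pos ((pow_two _).trans haa))).mul
      (hfin two_pos ((pow_two _).trans hbb))).subset ?_
    rintro _ ⟨i, e, f, rfl⟩
    exact Set.mul_mem_mul (Set.mul_mem_mul ⟨i, rfl⟩ ⟨e, rfl⟩) ⟨f, rfl⟩
  refine Set.finite_univ_iff.1 (hTfin.subset fun x _ => ?_)
  obtain ⟨g, rfl⟩ := QuotientGroup.mk'_surjective _ x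
  exact hT g

-- The generators in the algebra and their decompositions

variable (k : Type*) [Field k]

/-- The image of a group element in the algebra. -/
abbrev of : grigorchukGroup →* grigorchukAlgebra k := ofGroup k grigorchukGroup

theorem span_range_of : Submodule.span k (Set.range (of k)) = ⊤ := by
  rw [eq_top_iff]
  rintro ⟨_, r, rfl⟩ -
  induction r using MonoidAlgebra.induction_on with
  | of g =>
    refine Submodule.subset_span ⟨g, ?_⟩
    apply Subtype.ext
    simp [of, ofGroup]
  | add r s hr hs =>
    convert! add_mem hr hs using 1
    apply Subtype.ext
    simp
  | smul t r hr =>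
    convert! Submodule.smul_mem _ t hr using 1
    apply Subtype.ext
    simp

variable {k}

theorem mem_of_forall_of {P : Submodule k (grigorchukAlgebra k)} (h : ∀ g, of k g ∈ P) (x) :
    x ∈ P := by
  have : Submodule.span k (Set.range (of k)) ≤ P :=
    Submodule.span_le.2 (Set.range_subset_iff.2 h)
  rw [span_range_of] at this
  exact this trivial

variable (k)

theorem decomposition_of {g h : grigorchukGroup} {y z : Fin 2}
    (H : ∀ w, ((g : TreeAut (Fin 2)) : Equiv.Perm (List (Fin 2))) (y :: w) =
      z :: ((h : TreeAut (Fin 2)) : Equiv.Perm (List (Fin 2))) w) (x : Fin 2) :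
    grigorchukDecomposition k (of k g) x y = if x = z then of k h else 0 := by
  apply Subtype.ext
  refine (endDecomposition_boundaryRep k H x).trans ?_
  split_ifs <;> rfl

theorem decomposition_of_eq_diag {g h₀ h₁ : grigorchukGroup}
    (H₀ : ∀ w, ((g : TreeAut (Fin 2)) : Equiv.Perm (List (Fin 2))) (0 :: w) =
      0 :: ((h₀ : TreeAut (Fin 2)) : Equiv.Perm (List (Fin 2))) w)
    (H₁ : ∀ w, ((g : TreeAut (Fin 2)) : Equiv.Perm (List (Fin 2))) (1 :: w) =
      1 :: ((h₁ : TreeAut (Fin 2)) : Equiv.Perm (List (Fin 2))) w) :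
    grigorchukDecomposition k (of k g) = !![of k h₀, 0; 0, of k h₁] := by
  ext1 i j
  fin_cases j
  · refine (decomposition_of k H₀ i).trans ?_
    fin_cases i <;> simp
  · refine (decomposition_of k H₁ i).trans ?_
    fin_cases i <;> simp

theorem decomposition_a : grigorchukDecomposition k (of k a) = !![0, 1; 1, 0] := by
  ext1 i j
  have h : ∀ y : Fin 2, ∀ w, ((a : TreeAut (Fin 2)) : Equiv.Perm (List (Fin 2))) (y :: w) =
      Equiv.swap 0 1 y :: (((1 : grigorchukGroup) : TreeAut (Fin 2)) :
        Equiv.Perm (List (Fin 2))) w := fun _ _ => rfl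
  refine (decomposition_of k (h j) i).trans ?_
  rw [map_one]
  fin_cases i <;> fin_cases j <;> simp

theorem decomposition_b : grigorchukDecomposition k (of k b) = !![of k a, 0; 0, of k c] :=
  decomposition_of_eq_diag k (fun _ => rfl) (fun _ => rfl)

theorem decomposition_c : grigorchukDecomposition k (of k c) = !![of k a, 0; 0, of k d] :=
  decomposition_of_eq_diag k (fun _ => rfl) (fun _ => rfl)

theorem decomposition_d : grigorchukDecomposition k (of k d) = !![1, 0; 0, of k b] := by
  rw [decomposition_of_eq_diag k (g := d) (h₀ := 1) (h₁ := b) (fun _ => rfl) (fun _ => rfl),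
    map_one]

theorem aFun_cons (x : Fin 2) (w : List (Fin 2)) : aFun (x :: w) = Equiv.swap 0 1 x :: w := rfl

/-- Since `t` has sections `c a` and `a c` while `d` has sections `1` and `b`, the first section of
`[t, d]` is trivial and the second is `[a c, b] = c t c`. -/
theorem decomposition_s :
    grigorchukDecomposition k (of k s) = !![1, 0; 0, of k (c * t * c)] := by
  rw [decomposition_of_eq_diag k (g := s) (h₀ := 1) (h₁ := c * t * c), map_one]
  · intro w
    rw [s_eq]
    change bFun (aFun (bFun (aFun (dFun (aFun (bFun (aFun (bFun (dFun (0 :: w)))))))))) = 0 :: w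
    simp [aFun_cons, bFun, dFun, (bcdFun_involutive (aFun w)).2.1, aFun_involutive w]
  · intro w
    rw [s_eq, t_eq]
    change bFun (aFun (bFun (aFun (dFun (aFun (bFun (aFun (bFun (dFun (1 :: w)))))))))) =
      1 :: cFun (aFun (bFun (aFun (bFun (cFun w)))))
    simp [aFun_cons, bFun, dFun, (bcdFun_mul w).1.1, (bcdFun_mul w).2.1]

/-- An endomorphism is rebuilt from its blocks, because the products insertion-deletion sum to the
identity. -/
theorem decomposition_injective : Function.Injective (grigorchukDecomposition k) := by
  rw [injective_iff_map_eq_zero]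
  intro x hx
  apply Subtype.ext
  have h : ∀ i j, deleteLetter k i * (x : Module.End k ((ℕ → Fin 2) →₀ k)) * insertLetter k j = 0 :=
    fun i j => congrArg Subtype.val (congrFun (congrFun hx i) j)
  calc (x : Module.End k ((ℕ → Fin 2) →₀ k))
      = (∑ i, insertLetter k i * deleteLetter k i) * (x : Module.End k ((ℕ → Fin 2) →₀ k)) *
          ∑ j, insertLetter k j * deleteLetter k j := by
        rw [sum_insertLetter_deleteLetter, one_mul, mul_one]
    _ = ∑ i, ∑ j, insertLetter k i * (deleteLetter k i *
          (x : Module.End k ((ℕ → Fin 2) →₀ k)) * insertLetter k j) * deleteLetter k j := by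
        simp only [Finset.sum_mul, Finset.mul_sum, mul_assoc]
        rw [Finset.sum_comm]
    _ = 0 := by simp [h]

-- The elements `a b a`, `d`, `b`, `c` are diagonal with second sections `a`, `b`, `c`, `d`.
-- Products of them realise every group element in the second corner, and linearity does the rest.
variable {k} in
theorem exists_diagonal_lift (f : grigorchukAlgebra k) :
    ∃ u v, grigorchukDecomposition k u = !![v, 0; 0, f] := by
  let P : Submodule k (grigorchukAlgebra k) :=
    { carrier := {f | ∃ u v, grigorchukDecomposition k u = !![v, 0; 0, f]}
      zero_mem' := ⟨0, 0, by
        rw [map_zero]; ext1 i j; fin_cases i <;> fin_cases j <;> rfl⟩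
      add_mem' := by
        rintro f f' ⟨u, v, h⟩ ⟨u', v', h'⟩
        exact ⟨u + u', v + v', by rw [map_add, h, h']; simp⟩
      smul_mem' := by
        rintro r f ⟨u, v, h⟩
        exact ⟨r • u, r • v, by rw [map_smul, h]; simp⟩ }
  refine mem_of_forall_of (P := P) (fun g => ?_) f
  induction g using induction_left with
  | one => exact ⟨1, 1, by rw [map_one, map_one, Matrix.one_fin_two]⟩
  | ha g ih =>
    obtain ⟨u, v, h⟩ := ih
    refine ⟨of k a * of k b * of k a * u, of k c * v, ?_⟩
    simp [map_mul, h, decomposition_a, decomposition_b]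
  | hb g ih =>
    obtain ⟨u, v, h⟩ := ih
    refine ⟨of k d * u, v, ?_⟩
    simp [map_mul, h, decomposition_d]
  | hc g ih =>
    obtain ⟨u, v, h⟩ := ih
    refine ⟨of k b * u, of k a * v, ?_⟩
    simp [map_mul, h, decomposition_b]
  | hd g ih =>
    obtain ⟨u, v, h⟩ := ih
    refine ⟨of k c * u, of k a * v, ?_⟩
    simp [map_mul, h, decomposition_c]

/-- The element exchanging the letter `i` with the second letter. -/
def exchange (i : Fin 2) : grigorchukAlgebra k := if i = 0 then of k a else 1

theorem decomposition_exchange (i j : Fin 2) (u : grigorchukAlgebra k) :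
    grigorchukDecomposition k (exchange k i * u * exchange k j) i j =
      grigorchukDecomposition k u 1 1 := by
  rw [map_mul, map_mul, Matrix.eta_fin_two (grigorchukDecomposition k u)]
  fin_cases i <;> fin_cases j <;> simp [exchange, decomposition_a]

theorem decomposition_exchange_single (i j : Fin 2) {u p : grigorchukAlgebra k}
    (hu : grigorchukDecomposition k u = !![0, 0; 0, p]) :
    grigorchukDecomposition k (exchange k i * u * exchange k j) = Matrix.single i j p := by
  rw [map_mul, map_mul, hu]
  ext1 i' j'
  fin_cases i <;> fin_cases j <;> fin_cases i' <;> fin_cases j' <;>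
    simp [exchange, decomposition_a]

theorem isRecurrentTransitive : IsRecurrentTransitive (grigorchukDecomposition k) := by
  refine ⟨decomposition_injective k, fun i j f => ?_⟩
  obtain ⟨u, v, h⟩ := exists_diagonal_lift f
  refine ⟨exchange k i * u * exchange k j, ?_⟩
  change grigorchukDecomposition k (exchange k i * u * exchange k j) i j = f
  rw [decomposition_exchange, h]
  rfl

/-- The subspace underlying the branching ideal. -/
abbrev branchSubspace : Submodule k (grigorchukAlgebra k) :=
  idealSubspace k (grigorchukBranchingIdeal k)

-- The branching ideal

variable {k}

theorem mem_branchSubspace {x : grigorchukAlgebra k} :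
    x ∈ branchSubspace k ↔ x ∈ grigorchukBranchingIdeal k := TwoSidedIdeal.mem_asIdeal

theorem of_sub_one_mem {h : grigorchukGroup} (hh : h ∈ grigorchukBranchingSubgroup) :
    of k h - 1 ∈ grigorchukBranchingIdeal k := TwoSidedIdeal.subset_span ⟨h, hh, rfl⟩

/-- Modulo the ideal, a group element depends only on its coset, and there are finitely many cosets.
-/
theorem branchSubspace_coFG : (branchSubspace k).CoFG := by
  have := finite_quotient
  let F := Submodule.span k (Set.range fun q : grigorchukGroup ⧸ grigorchukBranchingSubgroup =>
    of k q.out)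
  refine coFG_of_fg_sup_eq_top (F := F) (Submodule.fg_span (Set.finite_range _)) ?_
  refine eq_top_iff.2 fun x _ => mem_of_forall_of (fun g => ?_) x
  obtain ⟨h, hh⟩ := QuotientGroup.mk_out_eq_mul grigorchukBranchingSubgroup g
  have : of k g = of k (g : grigorchukGroup ⧸ grigorchukBranchingSubgroup).out -
      of k g * (of k h - 1) := by
    rw [hh, map_mul]; noncomm_ring
  rw [this]
  refine sub_mem (Submodule.mem_sup_left (Submodule.subset_span ⟨_, rfl⟩))
    (Submodule.mem_sup_right (mem_branchSubspace.2 ?_))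
  exact TwoSidedIdeal.mul_mem_left _ _ _ (of_sub_one_mem h.2)

/-- The group elements `h` with `h - 1` in the right-hand side form a normal subgroup containing
`t`, hence containing the branching subgroup. A single ideal generator therefore suffices, as needed
for `coFG_pow`. -/
theorem branchSubspace_eq :
    branchSubspace k = ⊤ * Submodule.span k {of k t - 1} * ⊤ := by
  set P : Submodule k (grigorchukAlgebra k) := ⊤ * Submodule.span k {of k t - 1} * ⊤ with hP
  have hl : ∀ x, ∀ y ∈ P, x * y ∈ P := by
    intro x y hy
    have h : (⊤ : Submodule k (grigorchukAlgebra k)) * P ≤ P := by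
      rw [hP, ← mul_assoc, ← mul_assoc]
      exact mul_le_mul_left (mul_le_mul_left le_top _) _
    exact h (Submodule.mul_mem_mul Submodule.mem_top hy)
  have hr : ∀ x, ∀ y ∈ P, y * x ∈ P := by
    intro x y hy
    have h : P * (⊤ : Submodule k (grigorchukAlgebra k)) ≤ P := by
      rw [hP, mul_assoc]
      exact mul_le_mul_right le_top _
    exact h (Submodule.mul_mem_mul hy Submodule.mem_top)
  apply le_antisymm
  · let J : TwoSidedIdeal (grigorchukAlgebra k) :=
      TwoSidedIdeal.mk' (P : Set (grigorchukAlgebra k)) (zero_mem P) (add_mem (S := _) (s := P))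
        (fun h => neg_mem (S := Submodule k (grigorchukAlgebra k)) h) (fun {x y} => hl x y) (fun {x y} => hr y x)
    have hJ : ∀ x, x ∈ J ↔ x ∈ P := fun x => TwoSidedIdeal.mem_mk' _ _ _ _ _ _ _
    let N : Subgroup grigorchukGroup :=
      { carrier := {h | of k h - 1 ∈ P}
        one_mem' := by
          change of k 1 - 1 ∈ P
          rw [map_one, sub_self]
          exact zero_mem P
        mul_mem' := by
          intro g h hg hh
          change of k (g * h) - 1 ∈ P
          have : of k (g * h) - 1 = (of k g - 1) * of k h + (of k h - 1) := by
            rw [map_mul]; noncomm_ring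
          rw [this]
          exact add_mem (hr _ _ hg) hh
        inv_mem' := by
          intro g hg
          change of k g⁻¹ - 1 ∈ P
          have : of k g⁻¹ - 1 = -(of k g⁻¹ * (of k g - 1)) := by
            rw [mul_sub, ← map_mul, inv_mul_cancel, map_one]; noncomm_ring
          rw [this]
          exact neg_mem (hl _ _ hg) }
    have hN : N.Normal := ⟨fun h hh g => by
      change of k (g * h * g⁻¹) - 1 ∈ P
      have : of k (g * h * g⁻¹) - 1 = of k g * (of k h - 1) * of k g⁻¹ := by
        rw [mul_sub, sub_mul, mul_one, ← map_mul, ← map_mul, ← map_mul, mul_inv_cancel, map_one]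
      rw [this]
      exact hr _ _ (hl _ _ hh)⟩
    have ht : t ∈ N := by
      have h := Submodule.mul_mem_mul (Submodule.mul_mem_mul (Submodule.mem_top (R := k) (x := 1))
        (Submodule.mem_span_singleton_self (R := k) (of k t - 1)))
        (Submodule.mem_top (R := k) (x := (1 : grigorchukAlgebra k)))
      rwa [one_mul, mul_one] at h
    have hK : grigorchukBranchingSubgroup ≤ N := by
      rw [branchingSubgroup_eq]
      exact Subgroup.normalClosure_le_normal (Set.singleton_subset_iff.2 ht)
    have hKJ : grigorchukBranchingIdeal k ≤ J := by
      refine TwoSidedIdeal.span_le.2 ?_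
      rintro _ ⟨h, hh, rfl⟩
      exact (hJ _).2 (hK hh)
    exact fun x hx => (hJ x).1 (hKJ (mem_branchSubspace.1 hx))
  · rw [Submodule.mul_le]
    intro p hp y _
    obtain ⟨x, -, rfl⟩ := Submodule.mem_mul_span_singleton.1 hp
    exact mem_branchSubspace.2 (TwoSidedIdeal.mul_mem_right _ _ _
      (TwoSidedIdeal.mul_mem_left _ _ _ (of_sub_one_mem t_mem)))

/-- The heart of branching: `s - 1` is supported in the second corner with entry `c (t - 1) c`.
Diagonal lifts on both sides turn it into `x (t - 1) y`, and factors `a` move the corner to any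
position. -/
theorem exists_single_lift {p : grigorchukAlgebra k} (hp : p ∈ branchSubspace k) (i j : Fin 2) :
    ∃ u ∈ branchSubspace k, grigorchukDecomposition k u = Matrix.single i j p := by
  rw [branchSubspace_eq] at hp
  induction hp using Submodule.mul_induction_on' with
  | mem_mul_mem p hp y _ =>
    obtain ⟨x, -, rfl⟩ := Submodule.mem_mul_span_singleton.1 hp
    -- The extra factors `c` cancel those in `c (t - 1) c`. The unknown first entries `u'` and `v'`
    -- are multiplied by zero.
    obtain ⟨u, u', hu⟩ := exists_diagonal_lift (x * of k c)
    obtain ⟨v, v', hv⟩ := exists_diagonal_lift (of k c * y)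
    refine ⟨_, ?_, decomposition_exchange_single k i j (u := u * (of k s - 1) * v) ?_⟩
    · refine mem_branchSubspace.2 ?_
      exact TwoSidedIdeal.mul_mem_right _ _ _ (TwoSidedIdeal.mul_mem_left _ _ _
        (TwoSidedIdeal.mul_mem_right _ _ _ (TwoSidedIdeal.mul_mem_left _ _ _
          (of_sub_one_mem s_mem))))
    · have hcc : of k c * of k c = 1 := by rw [← map_mul, c_mul_c, map_one]
      have hs : grigorchukDecomposition k (of k s - 1) =
          !![0, 0; 0, of k c * (of k t - 1) * of k c] := by
        rw [map_sub, map_one, decomposition_s, Matrix.one_fin_two, mul_sub, sub_mul, mul_one, hcc]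
        ext1 i j
        fin_cases i <;> fin_cases j <;> simp
      rw [map_mul, map_mul, hu, hv, hs]
      have : x * of k c * (of k c * (of k t - 1) * of k c) * (of k c * y) =
          x * (of k t - 1) * y := by
        calc _ = x * (of k c * of k c) * (of k t - 1) * (of k c * of k c) * y := by
              simp only [mul_assoc]
          _ = _ := by rw [hcc, mul_one, mul_one]
      simp only [Matrix.mul_fin_two, mul_zero, zero_mul, add_zero, zero_add, this]
  | add x _ y _ hx hy =>
    obtain ⟨u, hu, hu'⟩ := hx
    obtain ⟨v, hv, hv'⟩ := hy
    exact ⟨u + v, add_mem hu hv, by rw [map_add, hu', hv', Matrix.single_add]⟩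

theorem isFiniteCodimBranchingIdeal :
    IsFiniteCodimBranchingIdeal (grigorchukDecomposition k) (grigorchukBranchingIdeal k) := by
  refine ⟨branchSubspace_coFG, fun M hM => ?_⟩
  choose u hu h using fun i j => exists_single_lift (hM i j) i j
  refine ⟨∑ i, ∑ j, u i j, Submodule.sum_mem _ fun i _ => Submodule.sum_mem _ fun j _ => hu i j, ?_⟩
  change grigorchukDecomposition k _ = M
  rw [Matrix.matrix_eq_sum_single M]
  simp only [map_sum, h]

theorem pull_branchSubspace_le :
    pull (grigorchukDecomposition k) (branchSubspace k) ≤ branchSubspace k := by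
  intro x hx
  exact mem_of_forall_single (decomposition_injective k)
    fun i j => exists_single_lift (hx i j) i j

theorem liftable_branchSubspace : Liftable (grigorchukDecomposition k) (branchSubspace k) := by
  intro p hp i j
  obtain ⟨u, -, hu⟩ := exists_single_lift hp i j
  refine ⟨u, mem_pull.2 fun i' j' => ?_, hu⟩
  rw [hu, Matrix.single_apply]
  split_ifs
  · exact hp
  · exact zero_mem _

theorem branchSubspace_pow_coFG (n : ℕ) : (branchSubspace k ^ (n + 1)).CoFG := by
  refine coFG_pow branchSubspace_coFG (Submodule.fg_span_singleton (of k t - 1)) ?_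
    branchSubspace_eq n
  rw [Submodule.span_singleton_le_iff_mem]
  exact mem_branchSubspace.2 (of_sub_one_mem t_mem)

-- Contraction to the nucleus

/-- The subspace spanned by the nucleus `1, a, b, c, d`. -/
def nucleusSpan (k : Type*) [Field k] : Submodule k (grigorchukAlgebra k) :=
  Submodule.span k {1, of k a, of k b, of k c, of k d}

theorem one_mem_nucleusSpan : (1 : grigorchukAlgebra k) ∈ nucleusSpan k :=
  Submodule.subset_span (by simp)
theorem a_mem_nucleusSpan : of k a ∈ nucleusSpan k := Submodule.subset_span (by simp)
theorem b_mem_nucleusSpan : of k b ∈ nucleusSpan k := Submodule.subset_span (by simp)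
theorem c_mem_nucleusSpan : of k c ∈ nucleusSpan k := Submodule.subset_span (by simp)
theorem d_mem_nucleusSpan : of k d ∈ nucleusSpan k := Submodule.subset_span (by simp)

theorem mem_pull_of_eq {P : Submodule k (grigorchukAlgebra k)} {x p q r s : grigorchukAlgebra k}
    (h : grigorchukDecomposition k x = !![p, q; r, s]) (hp : p ∈ P) (hq : q ∈ P) (hr : r ∈ P)
    (hs : s ∈ P) : x ∈ pull (grigorchukDecomposition k) P := by
  refine mem_pull.2 fun i j => ?_
  rw [h]
  fin_cases i <;> fin_cases j
  exacts [hp, hq, hr, hs]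

theorem nucleusSpan_le_pull :
    nucleusSpan k ≤ pull (grigorchukDecomposition k) (nucleusSpan k) := by
  have h0 := zero_mem (nucleusSpan k)
  refine Submodule.span_le.2 ?_
  rintro _ (rfl | rfl | rfl | rfl | rfl)
  · exact mem_pull_of_eq ((map_one _).trans Matrix.one_fin_two) one_mem_nucleusSpan h0 h0
      one_mem_nucleusSpan
  · exact mem_pull_of_eq (decomposition_a k) h0 one_mem_nucleusSpan one_mem_nucleusSpan h0
  · exact mem_pull_of_eq (decomposition_b k) a_mem_nucleusSpan h0 h0 c_mem_nucleusSpan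
  · exact mem_pull_of_eq (decomposition_c k) a_mem_nucleusSpan h0 h0 d_mem_nucleusSpan
  · exact mem_pull_of_eq (decomposition_d k) one_mem_nucleusSpan h0 h0 b_mem_nucleusSpan

/-- Multiplication by `a` permutes the rows of the decomposition. -/
theorem a_mul_mem_pull {P : Submodule k (grigorchukAlgebra k)} {x : grigorchukAlgebra k}
    (hx : x ∈ pull (grigorchukDecomposition k) P) :
    of k a * x ∈ pull (grigorchukDecomposition k) P := by
  refine mem_pull_of_eq (p := grigorchukDecomposition k x 1 0)
    (q := grigorchukDecomposition k x 1 1) (r := grigorchukDecomposition k x 0 0)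
    (s := grigorchukDecomposition k x 0 1) ?_ (hx 1 0) (hx 1 1) (hx 0 0) (hx 0 1)
  rw [map_mul, Matrix.eta_fin_two (grigorchukDecomposition k x), decomposition_a]
  simp

theorem mul_a_mem_pull {P : Submodule k (grigorchukAlgebra k)} {x : grigorchukAlgebra k}
    (hx : x ∈ pull (grigorchukDecomposition k) P) :
    x * of k a ∈ pull (grigorchukDecomposition k) P := by
  refine mem_pull_of_eq (p := grigorchukDecomposition k x 0 1)
    (q := grigorchukDecomposition k x 0 0) (r := grigorchukDecomposition k x 1 1)
    (s := grigorchukDecomposition k x 1 0) ?_ (hx 0 1) (hx 0 0) (hx 1 1) (hx 1 0)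
  rw [map_mul, Matrix.eta_fin_two (grigorchukDecomposition k x), decomposition_a]
  simp

/-- Factors `1` are harmless and factors `a` only permute rows or columns. The remaining products
stay in the Klein group `{1, b, c, d}`. -/
theorem nucleusSpan_mul_le :
    nucleusSpan k * nucleusSpan k ≤ pull (grigorchukDecomposition k) (nucleusSpan k) := by
  have h1 := nucleusSpan_le_pull (k := k) one_mem_nucleusSpan
  have hb := nucleusSpan_le_pull (k := k) b_mem_nucleusSpan
  have hc := nucleusSpan_le_pull (k := k) c_mem_nucleusSpan
  have hd := nucleusSpan_le_pull (k := k) d_mem_nucleusSpan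
  rw [nucleusSpan, Submodule.span_mul_span, ← nucleusSpan, Submodule.span_le]
  rintro _ ⟨x, hx, y, hy, rfl⟩
  change x * y ∈ pull _ _
  have hx' := nucleusSpan_le_pull (Submodule.subset_span hx)
  have hy' := nucleusSpan_le_pull (Submodule.subset_span hy)
  rcases hx with rfl | rfl | rfl | rfl | rfl
  · rwa [one_mul]
  · exact a_mul_mem_pull hy'
  all_goals
    rcases hy with rfl | rfl | rfl | rfl | rfl
    · rwa [mul_one]
    · exact mul_a_mem_pull hx'
    all_goals
      rw [← map_mul]
      simpa only [b_mul_b, b_mul_c, b_mul_d, c_mul_b, c_mul_c, c_mul_d, d_mul_b, d_mul_c, d_mul_d,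
        map_one]

/-- The algebra is contracting: the entries of the iterated decompositions of an element
eventually lie in the span of the nucleus. -/
theorem exists_mem_iterate_pull (x : grigorchukAlgebra k) :
    ∃ n, x ∈ (pull (grigorchukDecomposition k))^[n] (nucleusSpan k) := by
  have hmono {m n : ℕ} (h : m ≤ n) := le_iterate_pull (nucleusSpan_le_pull (k := k)) h
  have hmul : ∀ g x : grigorchukAlgebra k, g ∈ nucleusSpan k →
      (∃ n, x ∈ (pull (grigorchukDecomposition k))^[n] (nucleusSpan k)) →
      ∃ n, g * x ∈ (pull (grigorchukDecomposition k))^[n] (nucleusSpan k) := by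
    rintro g x hg ⟨n, hn⟩
    have hle : nucleusSpan k ≤ (pull (grigorchukDecomposition k))^[n] (nucleusSpan k) :=
      hmono (Nat.zero_le n)
    -- At level `n` the entries of `g * x` lie in the product of two nucleus spans; one more
    -- decomposition brings them back into the nucleus span.
    have h1 := iterate_pull_mul_le _ _ n (Submodule.mul_mem_mul (hle hg) hn)
    have h2 := iterate_pull_mono (ψ := grigorchukDecomposition k) nucleusSpan_mul_le n h1
    rw [← Function.iterate_succ_apply] at h2
    exact ⟨n + 1, h2⟩
  let P : Submodule k (grigorchukAlgebra k) :=
    { carrier := {x | ∃ n, x ∈ (pull (grigorchukDecomposition k))^[n] (nucleusSpan k)}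
      zero_mem' := ⟨0, zero_mem _⟩
      add_mem' := by
        rintro x y ⟨m, hm⟩ ⟨n, hn⟩
        exact ⟨max m n, add_mem (hmono (le_max_left m n) hm) (hmono (le_max_right m n) hn)⟩
      smul_mem' := by
        rintro r x ⟨m, hm⟩
        exact ⟨m, Submodule.smul_mem _ r hm⟩ }
  refine mem_of_forall_of (P := P) (fun g => ?_) x
  induction g using induction_left with
  | one => exact ⟨0, by rw [map_one]; exact one_mem_nucleusSpan⟩
  | ha g ih => rw [map_mul]; exact hmul _ _ a_mem_nucleusSpan ih
  | hb g ih => rw [map_mul]; exact hmul _ _ b_mem_nucleusSpan ih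
  | hc g ih => rw [map_mul]; exact hmul _ _ c_mem_nucleusSpan ih
  | hd g ih => rw [map_mul]; exact hmul _ _ d_mem_nucleusSpan ih

/-! ### The relation `1 + b + c + d = 0` in characteristic two -/

theorem of_apply_single (g : grigorchukGroup) (ξ : ℕ → Fin 2) :
    (of k g : Module.End k ((ℕ → Fin 2) →₀ k)) (Finsupp.single ξ 1) =
      Finsupp.single (boundaryFun (g : TreeAut (Fin 2)) ξ) 1 := by
  change Finsupp.mapDomain _ _ = _
  rw [Finsupp.mapDomain_single]
  rfl

theorem boundaryFun_consSeq {g h : TreeAut (Fin 2)} {y z : Fin 2}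
    (H : ∀ w, (g : Equiv.Perm (List (Fin 2))) (y :: w) = z :: (h : Equiv.Perm (List (Fin 2))) w)
    (ξ : ℕ → Fin 2) : boundaryFun g (consSeq y ξ) = consSeq z (boundaryFun h ξ) := by
  apply pref_injective
  intro n
  cases n with
  | zero => simp [pref]
  | succ n => rw [pref_boundaryFun, pref_consSeq, pref_consSeq, H, pref_boundaryFun]

theorem boundaryFun_one (ξ : ℕ → Fin 2) : boundaryFun (1 : TreeAut (Fin 2)) ξ = ξ :=
  pref_injective fun n => by rw [pref_boundaryFun]; rfl

theorem bcdFun_replicate (n : ℕ) :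
    bFun (List.replicate n 1) = List.replicate n 1 ∧
    cFun (List.replicate n 1) = List.replicate n 1 ∧
    dFun (List.replicate n 1) = List.replicate n 1 := by
  induction n with
  | zero => simp [bFun, cFun, dFun]
  | succ n ih => simp [List.replicate_succ, bFun, cFun, dFun, ih]

/-- After a first letter `0`, both `b` and `c` act as `a` while `1` and `d` act trivially, so the
four terms cancel in pairs. After a first letter `1`, the elements `b, c, d` are permuted and the
sum is that of the tail. -/
theorem sum_single_eq_zero (h2 : (2 : k) = 0) (n : ℕ) : ∀ ξ : ℕ → Fin 2, ξ n = 0 →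
    (Finsupp.single ξ 1 + Finsupp.single (boundaryFun bGen ξ) 1 +
      Finsupp.single (boundaryFun cGen ξ) 1 + Finsupp.single (boundaryFun dGen ξ) 1 :
      (ℕ → Fin 2) →₀ k) = 0 := by
  have h11 : (1 : k) + 1 = 0 := by rw [one_add_one_eq_two, h2]
  have hdouble : ∀ η : ℕ → Fin 2, (Finsupp.single η 1 + Finsupp.single η 1 :
      (ℕ → Fin 2) →₀ k) = 0 := fun η => by rw [← Finsupp.single_add, h11, Finsupp.single_zero]
  have hzero : ∀ η : ℕ → Fin 2, (Finsupp.single (consSeq 0 η) 1 +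
      Finsupp.single (boundaryFun bGen (consSeq 0 η)) 1 +
      Finsupp.single (boundaryFun cGen (consSeq 0 η)) 1 +
      Finsupp.single (boundaryFun dGen (consSeq 0 η)) 1 : (ℕ → Fin 2) →₀ k) = 0 := by
    intro η
    rw [boundaryFun_consSeq (g := bGen) (y := 0) (z := 0) (h := aGen) (fun _ => rfl),
      boundaryFun_consSeq (g := cGen) (y := 0) (z := 0) (h := aGen) (fun _ => rfl),
      boundaryFun_consSeq (g := dGen) (y := 0) (z := 0) (h := 1) (fun _ => rfl), boundaryFun_one,
      add_assoc (Finsupp.single _ _), hdouble, add_zero, hdouble]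
  induction n with
  | zero =>
    intro ξ hξ
    rw [← consSeq_head_tail ξ, hξ]
    exact hzero _
  | succ n ih =>
    intro ξ hξ
    rw [← consSeq_head_tail ξ]
    have h01 : ξ 0 = 0 ∨ ξ 0 = 1 := by
      generalize ξ 0 = x
      fin_cases x <;> simp
    rcases h01 with h | h
    · rw [h]
      exact hzero _
    · rw [h, boundaryFun_consSeq (g := bGen) (y := 1) (z := 1) (h := cGen) (fun _ => rfl),
        boundaryFun_consSeq (g := cGen) (y := 1) (z := 1) (h := dGen) (fun _ => rfl),
        boundaryFun_consSeq (g := dGen) (y := 1) (z := 1) (h := bGen) (fun _ => rfl)]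
      have := congrArg (insertLetter k (1 : Fin 2)) (ih (fun m => ξ (m + 1)) hξ)
      simp only [map_add, insertLetter_single, map_zero] at this
      rw [← this]
      abel

theorem one_add_b_add_c_add_d (h2 : (2 : k) = 0) : 1 + of k b + of k c + of k d = 0 := by
  apply Subtype.ext
  apply Finsupp.lhom_ext
  intro ξ r
  rw [← mul_one r, ← smul_eq_mul, ← Finsupp.smul_single, map_smul, map_smul]
  congr 1
  change Finsupp.single ξ 1 + (of k b : Module.End k ((ℕ → Fin 2) →₀ k)) (Finsupp.single ξ 1) +
    (of k c : Module.End k ((ℕ → Fin 2) →₀ k)) (Finsupp.single ξ 1) +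
    (of k d : Module.End k ((ℕ → Fin 2) →₀ k)) (Finsupp.single ξ 1) = 0
  simp only [of_apply_single]
  by_cases h : ∃ n, ξ n = 0
  · obtain ⟨n, hn⟩ := h
    exact sum_single_eq_zero h2 n ξ hn
  -- The only sequence without the letter `0` is fixed by `b`, `c` and `d`, so it contributes four
  -- equal terms.
  · have hξ : ξ = fun _ => 1 := by
      funext n
      have : ξ n ≠ 0 := fun hn => h ⟨n, hn⟩
      exact Fin.eq_one_of_ne_zero _ this
    have hpref : ∀ n, pref (fun _ : ℕ => (1 : Fin 2)) n = List.replicate n 1 := fun n => by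
      simp [pref]
    have hb : boundaryFun (b : TreeAut (Fin 2)) ξ = ξ := pref_injective fun n => by
      rw [pref_boundaryFun, hξ, hpref]; exact (bcdFun_replicate n).1
    have hc : boundaryFun (c : TreeAut (Fin 2)) ξ = ξ := pref_injective fun n => by
      rw [pref_boundaryFun, hξ, hpref]; exact (bcdFun_replicate n).2.1
    have hd : boundaryFun (d : TreeAut (Fin 2)) ξ = ξ := pref_injective fun n => by
      rw [pref_boundaryFun, hξ, hpref]; exact (bcdFun_replicate n).2.2
    rw [hb, hc, hd, ← Finsupp.single_add, ← Finsupp.single_add, ← Finsupp.single_add]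
    have : (1 : k) + 1 + 1 + 1 = 0 := by linear_combination 2 * h2
    rw [this, Finsupp.single_zero]

/-! ### Spreading of non-zero elements -/

theorem exists_spreadsAt_of_entry {x : grigorchukAlgebra k} (i j : Fin 2)
    (h : ∃ n, SpreadsAt (grigorchukDecomposition k) (branchSubspace k) n
      (grigorchukDecomposition k x i j)) :
    ∃ n, SpreadsAt (grigorchukDecomposition k) (branchSubspace k) n x := by
  obtain ⟨n, hn⟩ := h
  exact ⟨n + 1, hn.of_entry (decomposition_injective k) liftable_branchSubspace
    pull_branchSubspace_le⟩

/-- The linear combination of the elements of the nucleus with given coefficients. -/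
def nucleusComb (r₁ ra rb rc rd : k) : grigorchukAlgebra k :=
  r₁ • 1 + ra • of k a + rb • of k b + rc • of k c + rd • of k d

/-- The off-diagonal entries isolate the coefficient of `a`. The first diagonal entry adds
coefficients in pairs, and the second cyclically permutes those of `b, c, d`. -/
theorem decomposition_nucleusComb (r₁ ra rb rc rd : k) :
    grigorchukDecomposition k (nucleusComb r₁ ra rb rc rd) =
      !![nucleusComb (r₁ + rd) (rb + rc) 0 0 0, algebraMap k _ ra; algebraMap k _ ra,
        nucleusComb r₁ 0 rd rb rc] := by
  simp only [nucleusComb, map_add, map_smul, map_one, decomposition_a, decomposition_b,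
    decomposition_c, decomposition_d, Matrix.one_fin_two, Algebra.algebraMap_eq_smul_one]
  ext1 i j
  fin_cases i <;> fin_cases j <;> simp <;> module

theorem exists_nucleusComb {x : grigorchukAlgebra k} (hx : x ∈ nucleusSpan k) :
    ∃ r₁ ra rb rc rd, x = nucleusComb r₁ ra rb rc rd := by
  simp only [nucleusSpan, Submodule.mem_span_insert, Submodule.mem_span_singleton] at hx
  obtain ⟨r₁, _, ⟨ra, _, ⟨rb, _, ⟨rc, _, ⟨rd, rfl⟩, rfl⟩, rfl⟩, rfl⟩, rfl⟩ := hx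
  exact ⟨r₁, ra, rb, rc, rd, by simp only [nucleusComb, add_assoc]⟩

theorem exists_spreadsAt_of_a_ne_zero {r₁ ra rb rc rd : k} (h : ra ≠ 0) :
    ∃ n, SpreadsAt (grigorchukDecomposition k) (branchSubspace k) n
      (nucleusComb r₁ ra rb rc rd) := by
  refine exists_spreadsAt_of_entry 0 1 ⟨0, ?_⟩
  rw [decomposition_nucleusComb]
  exact spreadsAt_algebraMap _ h

/-- The first diagonal entry is `(r₁ + rd) + (rb + rc) a`: either `a` occurs in it, or it is a
non-zero scalar. -/
theorem exists_spreadsAt_of_ne_zero {r₁ rb rc rd : k} (h : rb + rc ≠ 0 ∨ r₁ + rd ≠ 0) :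
    ∃ n, SpreadsAt (grigorchukDecomposition k) (branchSubspace k) n
      (nucleusComb r₁ 0 rb rc rd) := by
  refine exists_spreadsAt_of_entry 0 0 ?_
  rw [decomposition_nucleusComb]
  change ∃ n, SpreadsAt _ _ n (nucleusComb (r₁ + rd) (rb + rc) 0 0 0)
  by_cases h' : rb + rc = 0
  · rw [h']
    refine ⟨0, ?_⟩
    have : (nucleusComb (r₁ + rd) 0 0 0 0 : grigorchukAlgebra k) = algebraMap k _ (r₁ + rd) := by
      simp only [nucleusComb, zero_smul, add_zero, Algebra.algebraMap_eq_smul_one]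
    rw [this]
    exact spreadsAt_algebraMap _ (h.resolve_left (not_not.2 h'))
  · exact exists_spreadsAt_of_a_ne_zero h'

/-- Without `a`, descending along the second diagonal entry rotates the coefficients of `b, c, d`,
so the test on the first diagonal entry can be made for all three rotations. -/
theorem exists_spreadsAt_of_mem_nucleusSpan {x : grigorchukAlgebra k} (hx : x ∈ nucleusSpan k)
    (h0 : x ≠ 0) : ∃ n, SpreadsAt (grigorchukDecomposition k) (branchSubspace k) n x := by
  obtain ⟨r₁, ra, rb, rc, rd, rfl⟩ := exists_nucleusComb hx
  by_cases ha : ra = 0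
  swap
  · exact exists_spreadsAt_of_a_ne_zero ha
  subst ha
  by_cases h₁ : rb + rc ≠ 0 ∨ r₁ + rd ≠ 0
  · exact exists_spreadsAt_of_ne_zero h₁
  refine exists_spreadsAt_of_entry 1 1 ?_
  rw [decomposition_nucleusComb]
  change ∃ n, SpreadsAt _ _ n (nucleusComb r₁ 0 rd rb rc)
  by_cases h₂ : rd + rb ≠ 0 ∨ r₁ + rc ≠ 0
  · exact exists_spreadsAt_of_ne_zero h₂
  refine exists_spreadsAt_of_entry 1 1 ?_
  rw [decomposition_nucleusComb]
  change ∃ n, SpreadsAt _ _ n (nucleusComb r₁ 0 rc rd rb)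
  by_cases h₃ : rc + rd ≠ 0 ∨ r₁ + rb ≠ 0
  · exact exists_spreadsAt_of_ne_zero h₃
  exfalso
  -- If all three tests fail, the six equations force all coefficients to equal `r₁` with `2 r₁ =
  -- 0`. Then `r₁ = 0` or the characteristic is two, and the element vanishes either way.
  push Not at h₁ h₂ h₃
  have hb : rb = r₁ := by linear_combination h₁.1 - h₂.2
  have h2r : r₁ * 2 = 0 := by linear_combination h₃.2 - hb
  have hc : rc = r₁ := by linear_combination h₂.2 - h2r
  have hd : rd = r₁ := by linear_combination h₁.2 - h2r
  rw [hb, hc, hd] at h0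
  refine h0 ?_
  have hx : nucleusComb r₁ 0 r₁ r₁ r₁ = r₁ • (1 + of k b + of k c + of k d) := by
    simp only [nucleusComb, zero_smul, add_zero, smul_add]
  rcases mul_eq_zero.1 h2r with h | h
  · rw [hx, h, zero_smul]
  · rw [hx, one_add_b_add_c_add_d h, smul_zero]

theorem exists_spreadsAt {x : grigorchukAlgebra k} (h0 : x ≠ 0) :
    ∃ n, SpreadsAt (grigorchukDecomposition k) (branchSubspace k) n x := by
  obtain ⟨n, hn⟩ := exists_mem_iterate_pull x
  induction n generalizing x with
  | zero => exact exists_spreadsAt_of_mem_nucleusSpan hn h0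
  | succ n ih =>
    rw [Function.iterate_succ_apply'] at hn
    have : ∃ i j, grigorchukDecomposition k x i j ≠ 0 := by
      by_contra! h
      refine h0 (decomposition_injective k ?_)
      rw [map_zero]
      ext1 i j
      exact h i j
    obtain ⟨i, j, h⟩ := this
    exact exists_spreadsAt_of_entry i j (ih h (hn i j))

/-- Otherwise `a` and `b` would commute in the algebra. Comparing entries gives `a = c`, impossible
since `c` is diagonal and `a` is not. -/
theorem of_t_ne_one : of k t ≠ 1 := by
  intro h
  have hba : of k b * of k a = of k a * of k b := by
    have h' : of k (b * a) * of k t = of k (b * a) := by rw [h, mul_one]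
    have e : b * a * t = a * b := by
      rw [t, ← mul_assoc, ← mul_assoc, ← mul_assoc, mul_inv_cancel_right, mul_inv_cancel, one_mul]
    rw [← map_mul, e, map_mul, map_mul] at h'
    exact h'.symm
  have h2 := congrArg (grigorchukDecomposition k) hba
  rw [map_mul, map_mul, decomposition_a, decomposition_b] at h2
  have h3 : of k a = of k c := by simpa using congrFun (congrFun h2 0) 1
  have h4 := congrFun (congrFun (congrArg (grigorchukDecomposition k) h3) 0) 1
  rw [decomposition_a, decomposition_c] at h4
  have h5 : (1 : grigorchukAlgebra k) = 0 := h4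
  exact one_ne_zero (congrArg Subtype.val h5)

/-- The branching ideal contains a copy of itself lifted from the corner `(0, 0)`. In finite
dimension the copy would be the whole ideal, but the lift of `t - 1` in the corner `(1, 1)` lies
outside it. -/
theorem not_finite : ¬ Module.Finite k (grigorchukAlgebra k) := by
  intro hfin
  let ψ := (grigorchukDecomposition k).toLinearMap
  have hψ : Function.Injective ψ := decomposition_injective k
  let σ : grigorchukAlgebra k →ₗ[k] Matrix (Fin 2) (Fin 2) (grigorchukAlgebra k) :=
    Matrix.singleLinearMap k 0 0
  have hσ : Function.Injective σ := fun p q h => by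
    have h' : Matrix.single (0 : Fin 2) (0 : Fin 2) p = Matrix.single 0 0 q := h
    simpa using congrFun (congrFun h' 0) 0
  let E : Submodule k (grigorchukAlgebra k) := ((branchSubspace k).map σ).comap ψ
  have hEI : E ≤ branchSubspace k := by
    rintro x ⟨p, hp, hx⟩
    obtain ⟨u, hu, hu'⟩ := exists_single_lift hp 0 0
    have : x = u := hψ (hx.symm.trans hu'.symm)
    rwa [this]
  have hE : E.map ψ = (branchSubspace k).map σ := by
    refine Submodule.map_comap_eq_of_le ?_
    rintro _ ⟨p, hp, rfl⟩
    obtain ⟨u, hu, hu'⟩ := exists_single_lift hp 0 0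
    exact ⟨u, hu'⟩
  have hrank : Module.finrank k E = Module.finrank k (branchSubspace k) := by
    rw [(Submodule.equivMapOfInjective ψ hψ E).finrank_eq, hE,
      ← (Submodule.equivMapOfInjective σ hσ _).finrank_eq]
  have hEq : E = branchSubspace k := Submodule.eq_of_le_of_finrank_eq hEI hrank
  obtain ⟨u, hu, hu'⟩ := exists_single_lift
    (mem_branchSubspace.2 (of_sub_one_mem (k := k) t_mem)) 1 1
  rw [← hEq] at hu
  obtain ⟨p, -, hp⟩ := hu
  have h : Matrix.single (0 : Fin 2) (0 : Fin 2) p = Matrix.single 1 1 (of k t - 1) := hp.trans hu'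
  have h' : of k t - 1 = 0 := by simpa using (congrFun (congrFun h 1) 1).symm
  exact of_t_ne_one (sub_eq_zero.1 h')

theorem exists_iterate_le {I : TwoSidedIdeal (grigorchukAlgebra k)} (hI : I ≠ ⊥) :
    ∃ n, (pull (grigorchukDecomposition k))^[n] (branchSubspace k) *
      (pull (grigorchukDecomposition k))^[n] (branchSubspace k) ≤ idealSubspace k I := by
  obtain ⟨x, hx, h0⟩ : ∃ x ∈ I, x ≠ 0 := by
    by_contra! h
    exact hI (le_bot_iff.1 fun x hx => (TwoSidedIdeal.mem_bot _).2 (h x hx))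
  obtain ⟨n, hn⟩ := exists_spreadsAt h0
  exact ⟨n, hn.le_of_mem hx⟩

theorem branchSubspace_mul_le : branchSubspace k * branchSubspace k ≤ branchSubspace k := by
  rw [Submodule.mul_le]
  intro x hx y _
  exact mem_branchSubspace.2 (TwoSidedIdeal.mul_mem_right _ _ _ (mem_branchSubspace.1 hx))

theorem iterate_pull_mul_self_ge {P : Submodule k (grigorchukAlgebra k)}
    (hP : P ≤ branchSubspace k) (n : ℕ) :
    (pull (grigorchukDecomposition k))^[n] (P * P) ≤
      (pull (grigorchukDecomposition k))^[n] P * (pull (grigorchukDecomposition k))^[n] P :=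
  iterate_pull_mul_ge (decomposition_injective k) liftable_branchSubspace pull_branchSubspace_le
    hP hP n

/-- A non-zero ideal contains `L L`, which contains the iterated preimage of the square of the
branching ideal, of finite codimension. -/
theorem isJustInfinite : IsJustInfinite k (grigorchukAlgebra k) := by
  refine ⟨not_finite, fun I hI => ?_⟩
  obtain ⟨n, hn⟩ := exists_iterate_le hI
  have h2 : (branchSubspace k * branchSubspace k).CoFG := by
    rw [← pow_two]
    exact branchSubspace_pow_coFG 1
  exact ((iterate_pull_coFG h2 n).of_le (iterate_pull_mul_self_ge le_rfl n)).of_le hn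

theorem isPrimeAlgebra : IsPrimeAlgebra (grigorchukAlgebra k) := by
  intro I J hI hJ
  by_contra! h
  obtain ⟨m, hm⟩ := exists_iterate_le hI
  obtain ⟨n, hn⟩ := exists_iterate_le hJ
  have hle {i j : ℕ} (hij : i ≤ j) := iterate_pull_le (pull_branchSubspace_le (k := k)) hij
  -- Iterated preimages of the branching ideal decrease with the level, so one `L` serves both
  -- ideals.
  set N := max m n
  set L := (pull (grigorchukDecomposition k))^[N] (branchSubspace k)
  have hLI : L * L ≤ idealSubspace k I :=
    (mul_le_mul' (hle (le_max_left m n)) (hle (le_max_left m n))).trans hm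
  have hLJ : L * L ≤ idealSubspace k J :=
    (mul_le_mul' (hle (le_max_right m n)) (hle (le_max_right m n))).trans hn
  have hzero : (L * L) * (L * L) ≤ ⊥ := by
    rw [Submodule.mul_le]
    intro x hx y hy
    exact (Submodule.mem_bot k).2 (h x (TwoSidedIdeal.mem_asIdeal.1 (hLI hx)) y
      (TwoSidedIdeal.mem_asIdeal.1 (hLJ hy)))
  have h4 : (branchSubspace k * branchSubspace k * (branchSubspace k * branchSubspace k)).CoFG := by
    have : branchSubspace k * branchSubspace k * (branchSubspace k * branchSubspace k) =
        branchSubspace k ^ (3 + 1) := by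
      rw [← pow_two, ← pow_two, ← pow_mul]
    rw [this]
    exact branchSubspace_pow_coFG 3
  -- The fourth power is split as a square of squares, so that the inclusion for squares can be used
  -- twice.
  have hge := (iterate_pull_mul_self_ge (branchSubspace_mul_le (k := k)) N).trans
    (mul_le_mul' (iterate_pull_mul_self_ge le_rfl N)
      (iterate_pull_mul_self_ge le_rfl N))
  have hbot : (⊥ : Submodule k (grigorchukAlgebra k)).CoFG :=
    ((iterate_pull_coFG h4 N).of_le hge).of_le hzero
  exact not_finite ((Module.Finite.iff_cofg_bot k _).1 hbot)

/-- The image contains the matrices over the branching ideal, which already have finite codimension.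
-/
theorem range_decomposition_coFG :
    (LinearMap.range (grigorchukDecomposition k).toLinearMap).CoFG :=
  (coFG_matrix branchSubspace_coFG).of_le
    (isFiniteCodimBranchingIdeal.2.trans (LinearMap.map_le_range))

end Grigorchuk
end TreeAlgebra

end

theorem mainTheorem3 (k : Type*) [Field k] :
    -- the algebra is regular branch, just-infinite and prime
    TreeAlgebra.IsRegularBranch (TreeAlgebra.grigorchukDecomposition k) ∧
    TreeAlgebra.IsJustInfinite k (TreeAlgebra.grigorchukAlgebra k) ∧
    TreeAlgebra.IsPrimeAlgebra (TreeAlgebra.grigorchukAlgebra k) ∧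
    -- the branching ideal has finite codimension in the algebra, and its image contains `M₂` of it
    TreeAlgebra.IsFiniteCodimBranchingIdeal (TreeAlgebra.grigorchukDecomposition k)
      (TreeAlgebra.grigorchukBranchingIdeal k) ∧
    -- the preimage of `M₂` of the branching ideal has finite codimension in the branching ideal
    (((TreeAlgebra.idealSubspace k (TreeAlgebra.grigorchukBranchingIdeal k)).matrix.comap
        (TreeAlgebra.grigorchukDecomposition k).toLinearMap).submoduleOf
      (TreeAlgebra.idealSubspace k (TreeAlgebra.grigorchukBranchingIdeal k))).CoFG ∧
    -- the image of the decomposition has finite codimension in `M₂` of the algebra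
    (LinearMap.range (TreeAlgebra.grigorchukDecomposition k).toLinearMap).CoFG := by
  open TreeAlgebra.Grigorchuk in
  exact ⟨⟨isRecurrentTransitive k, _, isFiniteCodimBranchingIdeal⟩, isJustInfinite, isPrimeAlgebra,
    isFiniteCodimBranchingIdeal,
    TreeAlgebra.coFG_comap _ (TreeAlgebra.pull_coFG branchSubspace_coFG),
    range_decomposition_coFG⟩
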